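/- Let $f:\mathbb R\to\mathbb R$ be a $C^\infty$ function with $f'(v)\ge 0$ for all $v\in\mathbb R$, and let $u_0\in L^\infty(\mathbb R)$. Call $u\in L^\infty(\mathbb R\times(0,\infty))$ a classical (entropy) solution of $$\partial_t u+\partial_x f(u)=0,\qquad u(x,0)=u_0(x),$$ if, for every $\varphi\in C_c^\infty(\mathbb R^2)$, $$\int_0^\infty\!\!\int_{\mathbb R}\big(u\,\partial_t\varphi+f(u)\,\partial_x\varphi\big)\,dx\,dt+\int_{\mathbb R}u_0(x)\,\varphi(x,0)\,dx=0,$$ and, for every differentiable strictly convex $U:\mathbb R\to\mathbb R$, every $F$ with $F'=U'f'$, and every nonnegative $\varphi\in C_c^\infty(\mathbb R^2)$, $$\int_0^\infty\!\!\int_{\mathbb R}\big(U(u)\,\partial_t\varphi+F(u)\,\partial_x\varphi\big)\,dx\,dt+\int_{\mathbb R}U(u_0(x))\,\varphi(x,0)\,dx\ge 0.$$ For mesh sizes $\Delta x,\Delta t>0$ put $x_{j+1/2}=j\Delta x$ for $j\in\mathbb Z$, and let $u^n_j$ ($n\in\mathbb N$, $j\in\mathbb Z$) be given by the upwind conservative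 scheme $$u^0_j=\frac1{\Delta x}\int_{x_{j-1/2}}^{x_{j+1/2}}u_0(x)\,dx,\qquad u^{n+1}_j=u^n_j-\frac{\Delta t}{\Delta x}\big(f(u^n_j)-f(u^n_{j-1})\big).$$ Let $u_{\Delta x,\Delta t}(x,t)=u^n_j$ for $x\in[x_{j-1/2},x_{j+1/2})$ and $t\in[n\Delta t,(n+1)\Delta t)$. Then there is a classical solution $u$, it is unique up to equality almost everywhere on $\mathbb R\times(0,\infty)$, and the upwind scheme converges to it: for all sequences $\Delta x_k,\Delta t_k>0$ that tend to $0$ and satisfy, for every $k$, the CFL condition $$\frac{\Delta t_k}{\Delta x_k}\,\max_{v\in A}|f'(v)|\le 1,\qquad A=[\operatorname{ess\,inf}u_0,\ \operatorname{ess\,sup}u_0],$$ one has $u_{\Delta x_k,\Delta t_k}\to u$ in $L^1_{loc}(\mathbb R\times[0,\infty))$, that is, $\iint_K|u_{\Delta x_k,\Delta t_k}-u|\,dx\,dt\to0$ for every compact $K\subset\mathbb R\times[0,\infty)$. -/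

import Mathlib

open MeasureTheory Filter Topology Set
open scoped ContDiff ENNReal

noncomputable section

namespace ScalarConservationLaw

/-- The open half-plane `ℝ × (0, ∞)`; its points are written `(x, t)`. -/
def halfPlane : Set (ℝ × ℝ) := {p | 0 < p.2}

/-- The partial derivative `∂ₓ φ`. -/
def dX (φ : ℝ × ℝ → ℝ) (p : ℝ × ℝ) : ℝ := fderiv ℝ φ p (1, 0)

/-- The partial derivative `∂ₜ φ`. -/
def dT (φ : ℝ × ℝ → ℝ) (p : ℝ × ℝ) : ℝ := fderiv ℝ φ p (0, 1)

/-- Test functions. They need not vanish at `t = 0`, so that the distributional formulations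
below contain the initial condition. -/
def IsTestFunction (φ : ℝ × ℝ → ℝ) : Prop :=
  ContDiff ℝ ∞ φ ∧ HasCompactSupport φ

/-- A strictly convex entropy pair for the flux `f`: `U` is differentiable and strictly convex,
and `F' = U' f'`. -/
structure IsEntropyPair (f U F : ℝ → ℝ) : Prop where
  differentiable : Differentiable ℝ U
  strictConvex : StrictConvexOn ℝ univ U
  hasDerivAt : ∀ v, HasDerivAt F (deriv U v * deriv f v) v

/-- The quantity `∬_{t > 0} (U(u) ∂ₜφ + F(u) ∂ₓφ) dx dt + ∫ U(u₀(x)) φ(x, 0) dx`. -/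
def weakForm (U F u₀ : ℝ → ℝ) (u φ : ℝ × ℝ → ℝ) : ℝ :=
  (∫ p in halfPlane, (U (u p) * dT φ p + F (u p) * dX φ p)) + ∫ x, U (u₀ x) * φ (x, 0)

/-- Bounded distributional solutions of `∂ₜu + ∂ₓf(u) = 0`, `u(·, 0) = u₀`. -/
structure IsWeakSolution (f u₀ : ℝ → ℝ) (u : ℝ × ℝ → ℝ) : Prop where
  memLp_top : MemLp u ∞ (volume.restrict halfPlane)
  weak : ∀ φ, IsTestFunction φ → weakForm id f u₀ u φ = 0

/-- Classical (entropy) solutions: weak solutions such that `∂ₜU(u) + ∂ₓF(u) ≤ 0` in the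
sense of distributions, with initial value `U(u₀)`, for every strictly convex entropy pair. -/
structure IsClassicalSolution (f u₀ : ℝ → ℝ) (u : ℝ × ℝ → ℝ) : Prop
    extends IsWeakSolution f u₀ u where
  entropy : ∀ U F, IsEntropyPair f U F →
    ∀ φ, IsTestFunction φ → (∀ p, 0 ≤ φ p) → 0 ≤ weakForm U F u₀ u φ

/-- The interface `x_{j+1/2} = j Δx`. -/
def interface (Δx : ℝ) (j : ℤ) : ℝ := j * Δx

/-- The mean value of `u₀` on the cell `C_j = [x_{j-1/2}, x_{j+1/2})`. -/
def cellAverage (Δx : ℝ) (u₀ : ℝ → ℝ) (j : ℤ) : ℝ :=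
  1 / Δx * ∫ x in interface Δx (j - 1)..interface Δx j, u₀ x

/-- One conservative step `w_j = v_j - (Δt/Δx) (g_{j+1/2} - g_{j-1/2})`; `g j` stands for the
numerical flux `g_{j+1/2}`. -/
def conservativeStep (Δx Δt : ℝ) (g v : ℤ → ℝ) (j : ℤ) : ℝ :=
  v j - Δt / Δx * (g j - g (j - 1))

/-- The values `u^n_j` of the conservative scheme with the upwind flux `f^n_{j+1/2} = f(u^n_j)`. -/
def upwind (f u₀ : ℝ → ℝ) (Δx Δt : ℝ) : ℕ → ℤ → ℝ
  | 0 => cellAverage Δx u₀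
  | n + 1 => conservativeStep Δx Δt (fun j => f (upwind f u₀ Δx Δt n j)) (upwind f u₀ Δx Δt n)

/-- The piecewise constant approximate solution: it equals `u^n_j` for `x` in `C_j` and `t` in
`[n Δt, (n+1) Δt)`. -/
def upwindApprox (f u₀ : ℝ → ℝ) (Δx Δt : ℝ) (p : ℝ × ℝ) : ℝ :=
  upwind f u₀ Δx Δt ⌊p.2 / Δt⌋₊ (⌊p.1 / Δx⌋ + 1)

/-- The range interval `A = [ess inf u₀, ess sup u₀]`. -/
def dataRange (u₀ : ℝ → ℝ) : Set ℝ := Icc (essInf u₀ volume) (essSup u₀ volume)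

/-- The condition `(Δt/Δx) max_{v ∈ A} |f'(v)| ≤ 1`. -/
def CFL (f u₀ : ℝ → ℝ) (Δx Δt : ℝ) : Prop :=
  ∀ v ∈ dataRange u₀, Δt / Δx * |deriv f v| ≤ 1

end ScalarConservationLaw

end

noncomputable section

namespace ScalarConservationLaw

open Metric

/-! Everything rests on one quantitative stability principle, `exists_almostKruzkov_stability`: two
functions with a common bound that satisfy Kruzkov's inequalities for the same initial data, up to a
small error uniform over a bounded class of test functions, are close in L¹ on balls of the
half-plane. It is used three times. Scheme against scheme, it makes the approximations a Cauchy
sequence in L¹_loc, which gives existence without BV bounds; solution against solution, it gives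
uniqueness; scheme against solution, it gives convergence.

The principle is proved by doubling variables with the kernel `ψ(x,t) ρ(x-y) θ(s-t)`. The operators
∂ₜ+∂ₛ and ∂ₓ+∂ᵧ annihilate the mollifiers and fall on `ψ`, which decays along cones of slope `L`, a
Lipschitz constant of `f` on the range. The weight `-(ψₜ + L|ψₓ|)` is therefore nonnegative for `t >
0` and bounded below on a prescribed ball. As `θ` is one-sided, only one initial term survives;
`initial_layer_le` reduces it to the oscillation of the data at the scale of `ρ`, which is small by
Lebesgue's differentiation theorem. The doubled difference `u(p) - v(q)` is turned into `u(p) -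
v(p)` by the triangle inequality, and `v(p) - v(q)` is controlled by the same estimate
(`kuznetsov_estimate`) for the pair `(v, v)`, so no modulus of continuity of the solutions enters.

For the scheme, `f' ≥ 0` and the CFL condition make `b - r (f b - f a)` nondecreasing in both
arguments. This yields the maximum principle and discrete entropy inequalities, for Kruzkov's
entropies and for all differentiable convex ones. Moving the differences to the test function
(`upwind_consistency`) gives the weak inequalities with an error of order `Δx + Δt`. The convex ones
pass to the limit and make it a classical solution (`isClassicalSolution_of_tendsto`). Conversely,
`|v - κ|` is a limit of strictly convex entropies, so classical solutions satisfy Kruzkov's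
inequalities (`almostKruzkov_of_entropy`); monotonicity of `f` is what makes `|f v - f κ|` the
matching entropy flux. -/

/-- Nonnegative test functions supported in the ball of radius `R` which are, together with their
first derivatives, `C`-Lipschitz. -/
structure TestBound (R C : ℝ) (φ : ℝ × ℝ → ℝ) : Prop where
  test : IsTestFunction φ
  nonneg : ∀ p, 0 ≤ φ p
  supp : ∀ p, R < ‖p‖ → φ p = 0
  le : ∀ p, φ p ≤ C
  lip : ∀ p q, |φ p - φ q| ≤ C * ‖p - q‖
  lipT : ∀ p q, |dT φ p - dT φ q| ≤ C * ‖p - q‖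
  lipX : ∀ p q, |dX φ p - dX φ q| ≤ C * ‖p - q‖

/-- The Kruzkov entropy inequalities with levels in `[-M, M]`, up to an error `e` for all test
functions with bounds `R`, `C`. -/
def AlmostKruzkov (f u₀ : ℝ → ℝ) (M R C e : ℝ) (u : ℝ × ℝ → ℝ) : Prop :=
  ∀ κ, |κ| ≤ M → ∀ φ, TestBound R C φ →
    -e ≤ weakForm (fun v => |v - κ|) (fun v => |f v - f κ|) u₀ u φ

/-! ### Calculus of test functions and their slices -/

theorem measurableSet_halfPlane : MeasurableSet halfPlane :=
  measurableSet_lt measurable_const measurable_snd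

theorem IsTestFunction.differentiable {φ : ℝ × ℝ → ℝ} (h : IsTestFunction φ) :
    Differentiable ℝ φ := h.1.differentiable (by simp)

theorem IsTestFunction.continuous_fderiv_apply {φ : ℝ × ℝ → ℝ} (h : IsTestFunction φ)
    (w : ℝ × ℝ) : Continuous fun p => fderiv ℝ φ p w :=
  (h.1.continuous_fderiv (by simp)).clm_apply continuous_const

theorem IsTestFunction.hasCompactSupport_fderiv_apply {φ : ℝ × ℝ → ℝ} (h : IsTestFunction φ)
    (w : ℝ × ℝ) : HasCompactSupport fun p => fderiv ℝ φ p w :=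
  (h.2.fderiv ℝ).comp_left (g := fun A : ℝ × ℝ →L[ℝ] ℝ => A w) (by simp)

theorem IsTestFunction.continuous_dT {φ : ℝ × ℝ → ℝ} (h : IsTestFunction φ) :
    Continuous (dT φ) := h.continuous_fderiv_apply _

theorem IsTestFunction.continuous_dX {φ : ℝ × ℝ → ℝ} (h : IsTestFunction φ) :
    Continuous (dX φ) := h.continuous_fderiv_apply _

theorem IsTestFunction.integrable_dT {φ : ℝ × ℝ → ℝ} (h : IsTestFunction φ) :
    Integrable (dT φ) :=
  h.continuous_dT.integrable_of_hasCompactSupport (h.hasCompactSupport_fderiv_apply _)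

theorem IsTestFunction.integrable_dX {φ : ℝ × ℝ → ℝ} (h : IsTestFunction φ) :
    Integrable (dX φ) :=
  h.continuous_dX.integrable_of_hasCompactSupport (h.hasCompactSupport_fderiv_apply _)

theorem IsTestFunction.integrable {φ : ℝ × ℝ → ℝ} (h : IsTestFunction φ) :
    Integrable φ :=
  h.1.continuous.integrable_of_hasCompactSupport h.2

theorem IsTestFunction.integrable_slice {φ : ℝ × ℝ → ℝ} (h : IsTestFunction φ) (t : ℝ) :
    Integrable fun x => φ (x, t) := by
  refine (h.1.continuous.comp (by fun_prop : Continuous fun x : ℝ => (x, t)))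
    |>.integrable_of_hasCompactSupport ?_
  obtain ⟨R, hR⟩ := h.2.isBounded.subset_closedBall 0
  refine HasCompactSupport.intro (isCompact_closedBall (0 : ℝ) R) fun x hx => ?_
  refine image_eq_zero_of_notMem_tsupport (f := φ) fun hmem => hx ?_
  have := hR hmem
  rw [mem_closedBall_zero_iff] at this ⊢
  exact (le_max_left _ _).trans (by simpa [Prod.norm_def] using this)

theorem hasDerivAt_slice_snd {φ : ℝ × ℝ → ℝ} (h : Differentiable ℝ φ) (x t : ℝ) :
    HasDerivAt (fun s => φ (x, s)) (dT φ (x, t)) t := by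
  have h1 : HasDerivAt (fun s : ℝ => ((x, s) : ℝ × ℝ)) (0, 1) t :=
    (hasDerivAt_const t x).prodMk (hasDerivAt_id t)
  exact (h (x, t)).hasFDerivAt.comp_hasDerivAt t h1

theorem hasDerivAt_slice_fst {φ : ℝ × ℝ → ℝ} (h : Differentiable ℝ φ) (x t : ℝ) :
    HasDerivAt (fun y => φ (y, t)) (dX φ (x, t)) x := by
  have h1 : HasDerivAt (fun y : ℝ => ((y, t) : ℝ × ℝ)) (1, 0) x :=
    (hasDerivAt_id x).prodMk (hasDerivAt_const x t)
  exact (h (x, t)).hasFDerivAt.comp_hasDerivAt x h1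

theorem integrable_of_bound_of_support {α : Type*} [MeasurableSpace α] {μ : Measure α}
    {g : α → ℝ} {s : Set α} {B : ℝ} (hg : Measurable g) (hs : μ s ≠ ⊤)
    (hB : ∀ x, |g x| ≤ B) (h0 : ∀ x, x ∉ s → g x = 0) : Integrable g μ := by
  rw [← integrableOn_iff_integrable_of_support_subset (s := s)
    (fun x hx => by_contra fun h => hx (h0 x h))]
  exact Measure.integrableOn_of_bounded (M := B) hs hg.aestronglyMeasurable
    (ae_of_all _ hB)

theorem fderiv_slice_fst {G : (ℝ × ℝ) × (ℝ × ℝ) → ℝ} (hG : Differentiable ℝ G)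
    (p q w : ℝ × ℝ) : fderiv ℝ (fun p => G (p, q)) p w = fderiv ℝ G (p, q) (w, 0) := by
  have h1 : HasFDerivAt (fun p : ℝ × ℝ => (p, q)) (ContinuousLinearMap.inl ℝ _ _) p :=
    hasFDerivAt_prodMk_left p q
  have := ((hG (p, q)).hasFDerivAt.comp p h1).fderiv
  simp only [Function.comp_def] at this
  rw [this]
  simp

theorem fderiv_slice_snd {G : (ℝ × ℝ) × (ℝ × ℝ) → ℝ} (hG : Differentiable ℝ G)
    (p q w : ℝ × ℝ) : fderiv ℝ (fun q => G (p, q)) q w = fderiv ℝ G (p, q) (0, w) := by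
  have h1 : HasFDerivAt (fun q : ℝ × ℝ => (p, q)) (ContinuousLinearMap.inr ℝ _ _) q :=
    hasFDerivAt_prodMk_right p q
  have := ((hG (p, q)).hasFDerivAt.comp q h1).fderiv
  simp only [Function.comp_def] at this
  rw [this]
  simp

/-- The slices of a smooth compactly supported function of two points are test functions with
uniform bounds. -/
theorem exists_testBound_slices {G : (ℝ × ℝ) × (ℝ × ℝ) → ℝ} (hG : ContDiff ℝ ∞ G)
    (hc : HasCompactSupport G) (h0 : ∀ z, 0 ≤ G z) :
    ∃ R C, 0 < R ∧ 0 ≤ C ∧ (∀ q, TestBound R C fun p => G (p, q)) ∧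
      (∀ p, TestBound R C fun q => G (p, q)) ∧
      (∀ z, R < ‖z‖ → G z = 0) ∧ (∀ z, R < ‖z‖ → fderiv ℝ G z = 0) := by
  obtain ⟨R, hR0, hR⟩ := hc.isBounded.subset_closedBall_lt 0 0
  obtain ⟨C0, hC0⟩ := hc.exists_bound_of_continuous hG.continuous
  obtain ⟨C1, hC1⟩ := hG.lipschitzWith_of_hasCompactSupport hc (by simp)
  have hG' : ContDiff ℝ ∞ (fderiv ℝ G) := hG.fderiv_right (by simp)
  obtain ⟨C2, hC2⟩ := hG'.lipschitzWith_of_hasCompactSupport (hc.fderiv ℝ) (by simp)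
  have hz : ∀ z, R < ‖z‖ → z ∉ tsupport G := fun z hz hmem => by
    have := hR hmem
    rw [mem_closedBall_zero_iff] at this
    linarith
  have hz1 : ∀ z, R < ‖z‖ → G z = 0 := fun z h => image_eq_zero_of_notMem_tsupport (hz z h)
  -- One constant serves all slices: the error in `AlmostKruzkov` is uniform only over a fixed class
  -- `TestBound R C`, and the inequalities for the slices will be integrated over the frozen point.
  set C : ℝ := max (max C0 C1) C2 with hC
  have hC00 : (C1 : ℝ) ≤ C := (le_max_right _ _).trans (le_max_left _ _)
  have hC22 : (C2 : ℝ) ≤ C := le_max_right _ _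
  have hCC : C0 ≤ C := (le_max_left _ _).trans (le_max_left _ _)
  have hlip : ∀ z w, |G z - G w| ≤ C * ‖z - w‖ := fun z w => by
    have := hC1.dist_le_mul z w
    rw [dist_eq_norm, dist_eq_norm] at this
    exact this.trans (by gcongr)
  have hlip2 : ∀ z w v, ‖v‖ ≤ 1 → |fderiv ℝ G z v - fderiv ℝ G w v| ≤ C * ‖z - w‖ := by
    intro z w v hv
    have := hC2.dist_le_mul z w
    rw [dist_eq_norm, dist_eq_norm] at this
    have h2 := (fderiv ℝ G z - fderiv ℝ G w).le_opNorm v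
    rw [_root_.sub_apply, Real.norm_eq_abs] at h2
    calc _ ≤ _ := h2
      _ ≤ ‖fderiv ℝ G z - fderiv ℝ G w‖ * 1 := by gcongr
      _ ≤ C * ‖z - w‖ := by rw [mul_one]; exact this.trans (by gcongr)
  have hd : Differentiable ℝ G := hG.differentiable (by simp)
  have n1 : ∀ p q r : ℝ × ℝ, ‖((p, q) : (ℝ × ℝ) × (ℝ × ℝ)) - (r, q)‖ = ‖p - r‖ := by
    intro p q r
    simp [Prod.norm_def]
  have n2 : ∀ p q r : ℝ × ℝ, ‖((q, p) : (ℝ × ℝ) × (ℝ × ℝ)) - (q, r)‖ = ‖p - r‖ := by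
    intro p q r
    simp [Prod.norm_def]
  have s1 : ∀ p q : ℝ × ℝ, R < ‖p‖ → G (p, q) = 0 := fun p q h =>
    hz1 _ (h.trans_le (le_max_left ‖p‖ ‖q‖))
  have s2 : ∀ p q : ℝ × ℝ, R < ‖q‖ → G (p, q) = 0 := fun p q h =>
    hz1 _ (h.trans_le (le_max_right ‖p‖ ‖q‖))
  have e1 : ‖(((0, 1), 0) : (ℝ × ℝ) × (ℝ × ℝ))‖ ≤ 1 := by simp [Prod.norm_def]
  have e2 : ‖(((1, 0), 0) : (ℝ × ℝ) × (ℝ × ℝ))‖ ≤ 1 := by simp [Prod.norm_def]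
  have e3 : ‖((0, (0, 1)) : (ℝ × ℝ) × (ℝ × ℝ))‖ ≤ 1 := by simp [Prod.norm_def]
  have e4 : ‖((0, (1, 0)) : (ℝ × ℝ) × (ℝ × ℝ))‖ ≤ 1 := by simp [Prod.norm_def]
  refine ⟨R, C, hR0, (NNReal.coe_nonneg C1).trans hC00, fun q => ?_, fun p => ?_, hz1,
    fun z h => ?_⟩
  · refine ⟨⟨hG.comp (by fun_prop), HasCompactSupport.intro (isCompact_closedBall 0 R)
      fun p hp => s1 p q ?_⟩, fun p => h0 _, fun p hp => s1 p q hp,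
      fun p => (le_abs_self _).trans ((hC0 _).trans hCC), fun p r => ?_, fun p r => ?_,
      fun p r => ?_⟩
    · simpa using hp
    · exact (hlip _ _).trans_eq (by rw [n1])
    · simp only [dT, fderiv_slice_fst hd]
      exact (hlip2 _ _ _ e1).trans_eq (by rw [n1])
    · simp only [dX, fderiv_slice_fst hd]
      exact (hlip2 _ _ _ e2).trans_eq (by rw [n1])
  · refine ⟨⟨hG.comp (by fun_prop), HasCompactSupport.intro (isCompact_closedBall 0 R)
      fun q hq => s2 p q ?_⟩, fun q => h0 _, fun q hq => s2 p q hq,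
      fun q => (le_abs_self _).trans ((hC0 _).trans hCC), fun q r => ?_, fun q r => ?_,
      fun q r => ?_⟩
    · simpa using hq
    · exact (hlip _ _).trans_eq (by rw [n2])
    · simp only [dT, fderiv_slice_snd hd]
      exact (hlip2 _ _ _ e3).trans_eq (by rw [n2])
    · simp only [dX, fderiv_slice_snd hd]
      exact (hlip2 _ _ _ e4).trans_eq (by rw [n2])
  · by_contra hne
    exact hz z h (support_fderiv_subset ℝ hne)

theorem exists_bound_on_Icc {f : ℝ → ℝ} (hf : Continuous f) (M : ℝ) :
    ∃ B, 0 ≤ B ∧ ∀ v, |v| ≤ M → |f v| ≤ B := by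
  obtain ⟨B, hB⟩ := (isCompact_Icc (a := -M) (b := M)).exists_bound_of_continuousOn
    hf.continuousOn
  exact ⟨max B 0, le_max_right _ _, fun v hv => (hB v (abs_le.1 hv)).trans (le_max_left _ _)⟩

theorem weakForm_congr_zero {U F u₀ : ℝ → ℝ} {u φ : ℝ × ℝ → ℝ} (h : ∀ p, φ p = 0) :
    weakForm U F u₀ u φ = 0 := by
  have : φ = fun _ => 0 := funext h
  subst this
  simp [weakForm, dT, dX]

/-! ### Doubling of variables -/

/-- Kruzkov's doubling of variables for a general smooth kernel `G`. -/
theorem doubling_inequality {f a : ℝ → ℝ} {M : ℝ} (hf : Continuous f) (ha : Measurable a)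
    (haM : ∀ x, |a x| ≤ M)
    {G : (ℝ × ℝ) × (ℝ × ℝ) → ℝ} (hG : ContDiff ℝ ∞ G) (hc : HasCompactSupport G)
    (hG0 : ∀ p : ℝ × ℝ, 0 < p.2 → ∀ y, G (p, (y, 0)) = 0) {R C e : ℝ}
    (hp : ∀ q, TestBound R C fun p => G (p, q)) (hq : ∀ p, TestBound R C fun q => G (p, q))
    (hz : ∀ z, R < ‖z‖ → G z = 0) (hz' : ∀ z, R < ‖z‖ → fderiv ℝ G z = 0)
    {u v : ℝ × ℝ → ℝ} (hu : Measurable u) (hv : Measurable v)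
    (huM : ∀ p, |u p| ≤ M) (hvM : ∀ p, |v p| ≤ M) (he : 0 ≤ e)
    (hue : AlmostKruzkov f a M R C e u) (hve : AlmostKruzkov f a M R C e v) :
    -(2 * e * volume.real (closedBall (0 : ℝ × ℝ) R)) ≤
      (∫ z, (|u z.1 - v z.2| * fderiv ℝ G z ((0, 1), (0, 1)) +
          |f (u z.1) - f (v z.2)| * fderiv ℝ G z ((1, 0), (1, 0)))
        ∂((volume.restrict halfPlane).prod (volume.restrict halfPlane))) +
      ∫ q in halfPlane, ∫ x, |a x - v q| * G ((x, 0), q) := by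
  set μ : Measure (ℝ × ℝ) := volume.restrict halfPlane with hμ
  obtain ⟨B, hB0, hB⟩ := exists_bound_on_Icc hf M
  have hd : Differentiable ℝ G := hG.differentiable (by simp)
  have hfm := hf.measurable
  have hDc : ∀ w, Continuous fun z => fderiv ℝ G z w := fun w =>
    (hG.continuous_fderiv (by simp)).clm_apply continuous_const
  have hDm : ∀ w, Measurable fun z => fderiv ℝ G z w := fun w => (hDc w).measurable
  have hDb : ∀ w, ∃ D, ∀ z, |fderiv ℝ G z w| ≤ D := fun w =>
    ((hc.fderiv ℝ).comp_left (g := fun A : (ℝ × ℝ) × (ℝ × ℝ) →L[ℝ] ℝ => A w)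
      (by simp)).exists_bound_of_continuous (hDc w)
  have hball : ∀ z : (ℝ × ℝ) × (ℝ × ℝ), z ∉ closedBall 0 R → R < ‖z‖ := fun z h => by
    simpa using h
  have hfin : (μ.prod μ) (closedBall 0 R) ≠ ⊤ :=
    (isCompact_closedBall (0 : (ℝ × ℝ) × (ℝ × ℝ)) R).measure_lt_top.ne
  have hI1 : ∀ w, Integrable (fun z => |u z.1 - v z.2| * fderiv ℝ G z w) (μ.prod μ) := by
    intro w
    obtain ⟨D, hD⟩ := hDb w
    have := hDm w
    refine integrable_of_bound_of_support (B := (M + M) * D) (by fun_prop) hfin (fun z => ?_)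
      (fun z h => by simp [hz' z (hball z h)])
    rw [abs_mul, abs_abs]
    have := (abs_sub (u z.1) (v z.2)).trans (add_le_add (huM _) (hvM _))
    exact mul_le_mul this (hD z) (abs_nonneg _) ((abs_nonneg _).trans this)
  have hI2 : ∀ w, Integrable (fun z => |f (u z.1) - f (v z.2)| * fderiv ℝ G z w) (μ.prod μ) := by
    intro w
    obtain ⟨D, hD⟩ := hDb w
    have := hDm w
    refine integrable_of_bound_of_support (B := (B + B) * D) (by fun_prop) hfin (fun z => ?_)
      (fun z h => by simp [hz' z (hball z h)])
    rw [abs_mul, abs_abs]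
    have := (abs_sub (f (u z.1)) (f (v z.2))).trans (add_le_add (hB _ (huM _)) (hB _ (hvM _)))
    exact mul_le_mul this (hD z) (abs_nonneg _) ((abs_nonneg _).trans this)
  -- `w` and `w'` are time directions at the first and second point; swapping their coordinates
  -- gives the matching space directions. Thus `K (0, 1) 0` belongs to the inequality for `u` and `K
  -- 0 (0, 1)` to that for `v`; by linearity of the derivative they add up to the full integrand.
  set K : ℝ × ℝ → ℝ × ℝ → (ℝ × ℝ) × (ℝ × ℝ) → ℝ := fun w w' z =>
    |u z.1 - v z.2| * fderiv ℝ G z (w, w') + |f (u z.1) - f (v z.2)| *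
      fderiv ℝ G z ((w.2, w.1), (w'.2, w'.1)) with hK
  have hKi : ∀ w w', Integrable (K w w') (μ.prod μ) := fun w w' => (hI1 _).add (hI2 _)
  have hI3 : Integrable (fun z : (ℝ × ℝ) × ℝ => |a z.2 - v z.1| * G ((z.2, 0), z.1))
      (μ.prod volume) := by
    have hGm : Measurable G := hG.continuous.measurable
    obtain ⟨D, hD⟩ := hc.exists_bound_of_continuous hG.continuous
    refine integrable_of_bound_of_support (B := (M + M) * D) (s := closedBall 0 R) (by fun_prop)
      (isCompact_closedBall (0 : (ℝ × ℝ) × ℝ) R).measure_lt_top.ne (fun z => ?_) (fun z h => ?_)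
    · rw [abs_mul, abs_abs]
      have := (abs_sub (a z.2) (v z.1)).trans (add_le_add (haM _) (hvM _))
      exact mul_le_mul this (hD _) (abs_nonneg _) ((abs_nonneg _).trans this)
    · rw [hz, mul_zero]
      have h' : R < ‖z‖ := by simpa using h
      refine h'.trans_le ?_
      simp only [Prod.norm_def, norm_zero]
      refine max_le (le_max_right _ _) ((le_max_left _ _).trans (le_max_left _ _))
  -- Integrating the lower bound `-e` over the frozen point costs only the volume of a ball, since
  -- both sides vanish outside it.
  have hS : ∀ w : ℝ × ℝ → ℝ, Integrable w μ → (∀ p, p.2 > 0 → -e ≤ w p) →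
      (∀ p, R < ‖p‖ → w p = 0) → -(e * volume.real (closedBall (0 : ℝ × ℝ) R)) ≤ ∫ p, w p ∂μ := by
    intro w hw h1 h2
    have hi : Integrable (indicator (closedBall (0 : ℝ × ℝ) R) fun _ => -e) μ :=
      (integrable_indicator_iff measurableSet_closedBall).2
        (integrableOn_const (isCompact_closedBall _ _).measure_lt_top.ne)
    calc -(e * volume.real (closedBall (0 : ℝ × ℝ) R))
        ≤ -(e * μ.real (closedBall (0 : ℝ × ℝ) R)) := by
          rw [neg_le_neg_iff]
          refine mul_le_mul_of_nonneg_left ?_ he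
          exact ENNReal.toReal_mono (isCompact_closedBall _ _).measure_lt_top.ne
            (Measure.restrict_apply_le _ _)
      _ = ∫ p, indicator (closedBall (0 : ℝ × ℝ) R) (fun _ => -e) p ∂μ := by
          rw [integral_indicator measurableSet_closedBall]
          simp [mul_comm]
      _ ≤ ∫ p, w p ∂μ := by
          refine integral_mono_ae hi hw ?_
          rw [hμ]
          filter_upwards [ae_restrict_mem measurableSet_halfPlane] with p hp
          by_cases hpR : p ∈ closedBall (0 : ℝ × ℝ) R
          · rw [indicator_of_mem hpR]
            exact h1 p hp
          · rw [indicator_of_notMem hpR, h2 p (by simpa using hpR)]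
  -- Freeze `q`, take `v q` as the Kruzkov level for `u`, and integrate in `q`. The roles are
  -- exchanged in `hBq`.
  have hA : -(e * volume.real (closedBall (0 : ℝ × ℝ) R)) ≤
      (∫ z, K (0, 1) 0 z ∂(μ.prod μ)) + ∫ q, (∫ x, |a x - v q| * G ((x, 0), q)) ∂μ := by
    have hsw : Integrable (fun q => ∫ p, K (0, 1) 0 (p, q) ∂μ) μ :=
      (hKi _ _).swap.integral_prod_left
    have h3 : Integrable (fun q => ∫ x, |a x - v q| * G ((x, 0), q)) μ :=
      hI3.integral_prod_left
    rw [integral_prod_symm _ (hKi _ _), ← integral_add hsw h3]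
    have hw : ∀ q, (∫ p, K (0, 1) 0 (p, q) ∂μ) + ∫ x, |a x - v q| * G ((x, 0), q) =
        weakForm (fun s => |s - v q|) (fun s => |f s - f (v q)|) a u (fun p => G (p, q)) := by
      intro q
      simp only [weakForm, dT, dX, fderiv_slice_fst hd, hK]
      rfl
    refine hS _ (hsw.add h3) (fun q _ => ?_) (fun q hqR => ?_)
    · rw [hw]
      exact hue _ (hvM q) _ (hp q)
    · rw [hw]
      exact weakForm_congr_zero fun p => hz _ (hqR.trans_le (le_max_right ‖p‖ ‖q‖))
  have hBq : -(e * volume.real (closedBall (0 : ℝ × ℝ) R)) ≤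
      (∫ z, K 0 (0, 1) z ∂(μ.prod μ)) := by
    rw [integral_prod _ (hKi _ _)]
    have hw : ∀ p : ℝ × ℝ, (∫ q, K 0 (0, 1) (p, q) ∂μ) + ∫ y, |a y - u p| * G (p, (y, 0)) =
        weakForm (fun s => |s - u p|) (fun s => |f s - f (u p)|) a v (fun q => G (p, q)) := by
      intro p
      simp only [weakForm, dT, dX, fderiv_slice_snd hd, hK, abs_sub_comm (u p),
        abs_sub_comm (f (u p))]
      rfl
    refine hS _ (hKi _ _).integral_prod_left (fun p hp0 => ?_) (fun p hpR => ?_)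
    -- The initial term of `v` is removed by `hG0`.
    · have := hw p
      simp only [hG0 p hp0, mul_zero, integral_zero, add_zero] at this
      rw [this]
      exact hve _ (huM p) _ (hq p)
    · refine integral_eq_zero_of_ae (ae_of_all _ fun q => ?_)
      have := hz' (p, q) (hpR.trans_le (le_max_left ‖p‖ ‖q‖))
      simp [hK, this]
  have hsum : (∫ z, (|u z.1 - v z.2| * fderiv ℝ G z ((0, 1), (0, 1)) +
          |f (u z.1) - f (v z.2)| * fderiv ℝ G z ((1, 0), (1, 0))) ∂(μ.prod μ)) =
      (∫ z, K (0, 1) 0 z ∂(μ.prod μ)) + ∫ z, K 0 (0, 1) z ∂(μ.prod μ) := by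
    rw [← integral_add (hKi _ _) (hKi _ _)]
    refine integral_congr_ae (ae_of_all _ fun z => ?_)
    have h1 : (((0, 1), (0, 1)) : (ℝ × ℝ) × (ℝ × ℝ)) = ((0, 1), 0) + (0, (0, 1)) := by simp
    have h2 : (((1, 0), (1, 0)) : (ℝ × ℝ) × (ℝ × ℝ)) = ((1, 0), 0) + (0, (1, 0)) := by simp
    simp only [hK, h1, h2, map_add, Prod.fst_zero, Prod.snd_zero, Prod.mk_zero_zero]
    ring
  rw [hsum]
  linarith

/-! ### Mollifiers, cutoffs and the cone weight -/

/-- A one-sided mollifier `θ` in time, together with a cutoff `χ` such that `χ' = -θ` for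
positive times. -/
structure IsTimeKernel (τ : ℝ) (θ χ : ℝ → ℝ) : Prop where
  smooth : ContDiff ℝ ∞ θ
  nonneg : ∀ s, 0 ≤ θ s
  zero_of_le : ∀ s, s ≤ 0 → θ s = 0
  zero_of_ge : ∀ s, τ ≤ s → θ s = 0
  integral : ∫ s, θ s = 1
  cutoff_smooth : ContDiff ℝ ∞ χ
  cutoff_nonneg : ∀ s, 0 ≤ χ s
  cutoff_le : ∀ s, χ s ≤ 1
  cutoff_zero : χ 0 = 1
  cutoff_of_ge : ∀ s, τ ≤ s → χ s = 0
  cutoff_of_le : ∀ s, s ≤ -2 → χ s = 0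
  hasDerivAt : ∀ s, 0 < s → HasDerivAt χ (-θ s) s

/-- Let `h` be a smooth step from 0 at time 0 to 1 at time `τ`; take `θ = h'` and `χ = 1 - h`. The
extra factor of `χ` equals 1 for `s ≥ -1` and only provides the cutoff in the past that compactly
supported test functions need. -/
theorem exists_isTimeKernel {τ : ℝ} (hτ : 0 < τ) : ∃ θ χ, IsTimeKernel τ θ χ := by
  set h : ℝ → ℝ := fun s => Real.smoothTransition (s / τ) with hh
  have hs : ContDiff ℝ ∞ h := Real.smoothTransition.contDiff.comp (by fun_prop)
  have hd : ∀ s, HasDerivAt h (deriv h s) s := fun s =>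
    (hs.differentiable (by simp) s).hasDerivAt
  have h0 : ∀ s, s ≤ 0 → h s = 0 := fun s hs =>
    Real.smoothTransition.zero_of_nonpos (div_nonpos_of_nonpos_of_nonneg hs hτ.le)
  have h1 : ∀ s, τ ≤ s → h s = 1 := fun s hs =>
    Real.smoothTransition.one_of_one_le ((one_le_div hτ).2 hs)
  have hθs : ContDiff ℝ ∞ (deriv h) := (contDiff_infty_iff_deriv.1 hs).2
  have hz0 : ∀ s, s ≤ 0 → deriv h s = 0 := fun s hs =>
    IsLocalMin.deriv_eq_zero (Eventually.of_forall fun r => by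
      rw [h0 s hs]; exact Real.smoothTransition.nonneg _)
  have hz1 : ∀ s, τ ≤ s → deriv h s = 0 := fun s hs =>
    IsLocalMax.deriv_eq_zero (Eventually.of_forall fun r => by
      rw [h1 s hs]; exact Real.smoothTransition.le_one _)
  have hmono : Monotone h := fun s r hsr =>
    Real.smoothTransition.monotone (div_le_div_of_nonneg_right hsr hτ.le)
  refine ⟨deriv h, fun s => (1 - h s) * Real.smoothTransition (s + 2), ?_⟩
  refine ⟨hθs, fun s => hmono.deriv_nonneg, hz0, hz1, ?_, ?_, ?_, ?_, ?_, ?_, ?_, ?_⟩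
  · have hi : Integrable (deriv h) := by
      refine hθs.continuous.integrable_of_hasCompactSupport
        (HasCompactSupport.intro (isCompact_Icc (a := 0) (b := τ)) fun s hs => ?_)
      rcases le_total s 0 with h | h
      · exact hz0 s h
      · refine hz1 s (le_of_not_ge fun h' => hs ⟨h, h'⟩)
    rw [integral_of_hasDerivAt_of_tendsto hd hi
      (tendsto_const_nhds.congr' ((eventually_le_atBot 0).mono fun s hs => (h0 s hs).symm))
      (tendsto_const_nhds.congr' ((eventually_ge_atTop τ).mono fun s hs => (h1 s hs).symm))]
    norm_num
  · exact (contDiff_const.sub hs).mul (Real.smoothTransition.contDiff.comp (by fun_prop))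
  · exact fun s => mul_nonneg (sub_nonneg.2 (Real.smoothTransition.le_one _))
      (Real.smoothTransition.nonneg _)
  · refine fun s => mul_le_one₀ ?_ (Real.smoothTransition.nonneg _)
      (Real.smoothTransition.le_one _)
    linarith [Real.smoothTransition.nonneg (s / τ)]
  · simp only [h0 0 le_rfl]
    rw [Real.smoothTransition.one_of_one_le (by norm_num)]
    norm_num
  · intro s hs
    simp [h1 s hs]
  · intro s hs
    simp only [Real.smoothTransition.zero_of_nonpos (show s + 2 ≤ 0 by linarith), mul_zero]
  · intro s hs
    refine ((hd s).const_sub 1).congr_of_eventuallyEq ?_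
    filter_upwards [lt_mem_nhds hs] with r hr
    rw [Real.smoothTransition.one_of_one_le (by linarith), mul_one]

/-- An even mollifier in space. -/
structure IsSpaceKernel (ε : ℝ) (ρ : ℝ → ℝ) : Prop where
  smooth : ContDiff ℝ ∞ ρ
  nonneg : ∀ x, 0 ≤ ρ x
  symm : ∀ x, ρ (-x) = ρ x
  zero_of_ge : ∀ x, ε ≤ |x| → ρ x = 0
  integral : ∫ x, ρ x = 1
  le : ∀ x, ρ x ≤ 1 / ε

/-- The normalized bump is at most the reciprocal of the length of its inner ball; inner radius `ε /
2` makes this exactly `1 / ε`. -/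
theorem exists_isSpaceKernel {ε : ℝ} (hε : 0 < ε) : ∃ ρ, IsSpaceKernel ε ρ := by
  let b : ContDiffBump (0 : ℝ) := ⟨ε / 2, ε, by linarith, by linarith⟩
  refine ⟨b.normed volume, b.contDiff_normed, b.nonneg_normed, b.normed_neg, fun x hx => ?_,
    b.integral_normed, fun x => ?_⟩
  · by_contra hne
    have : x ∈ Function.support (b.normed volume) := hne
    rw [b.support_normed_eq] at this
    simp only [mem_ball, dist_zero_right, Real.norm_eq_abs] at this
    exact absurd hx (not_le.2 this)
  · refine (b.normed_le_div_measure_closedBall_rIn volume x).trans_eq ?_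
    have : volume.real (closedBall (0 : ℝ) b.rIn) = ε := by
      rw [Real.volume_real_closedBall b.rIn_pos.le]
      change 2 * (ε / 2) = ε
      ring
    rw [this]

/-- A test function which decays along the characteristic cone of slope `L`. -/
theorem exists_cone_weight {L : ℝ} (hL : 0 ≤ L) {R₀ : ℝ} (hR₀ : 0 ≤ R₀) :
    ∃ ψ : ℝ × ℝ → ℝ, IsTestFunction ψ ∧ (∀ p, 0 ≤ ψ p) ∧
      (∀ p, 0 < p.2 → dT ψ p + L * |dX ψ p| ≤ 0) ∧
      ∃ c > 0, ∀ p ∈ closedBall (0 : ℝ × ℝ) R₀, 0 < p.2 → dT ψ p + L * |dX ψ p| ≤ -c := by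
  -- A smooth substitute for `|x|` with `|q'| ≤ 1`.
  set q : ℝ → ℝ := fun x => √(1 + x ^ 2) with hq
  have hpos : ∀ x : ℝ, 0 < 1 + x ^ 2 := fun x => by positivity
  have hqs : ContDiff ℝ ∞ q := ContDiff.sqrt (by fun_prop) fun x => (hpos x).ne'
  have hqx : ∀ x, |x| ≤ q x := fun x => Real.abs_le_sqrt (by linarith)
  have hq0 : ∀ x, 0 < q x := fun x => Real.sqrt_pos.2 (hpos x)
  have hqd : ∀ x, HasDerivAt q (x / q x) x := by
    intro x
    have := ((hasDerivAt_pow 2 x).const_add 1).sqrt (hpos x).ne'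
    convert this using 1
    simp only [hq]
    field_simp
    norm_num [mul_comm]
  -- Chosen so that `R₂ - q x - (L + 1) t` lies in `[1, R₂]` for `|x| ≤ R₀` and `0 < t ≤ R₀`; on
  -- that interval the derivative of `E` has a positive lower bound.
  set R₂ : ℝ := 1 + √(1 + R₀ ^ 2) + (L + 1) * R₀ with hR₂
  have hR₂0 : 0 < R₂ := by positivity
  set E : ℝ → ℝ := expNegInvGlue with hE
  have hEs : ContDiff ℝ ∞ E := expNegInvGlue.contDiff
  have hEd : ∀ z, HasDerivAt E (deriv E z) z := fun z =>
    (hEs.differentiable (by simp) z).hasDerivAt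
  have hE' : ∀ z, 0 ≤ deriv E z := fun z => expNegInvGlue.monotone.deriv_nonneg
  have hEc : ∀ z, 1 ≤ z → z ≤ R₂ → Real.exp (-1) / R₂ ^ 2 ≤ deriv E z := by
    intro z h1 h2
    have hz : 0 < z := by linarith
    have hd : HasDerivAt E (Real.exp (-z⁻¹) * (z ^ 2)⁻¹) z := by
      have := ((hasDerivAt_inv hz.ne').neg).exp
      rw [neg_neg] at this
      refine this.congr_of_eventuallyEq ?_
      filter_upwards [lt_mem_nhds hz] with y hy
      simp [hE, expNegInvGlue, not_le.2 hy]
    rw [hd.deriv, div_eq_mul_inv]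
    have : z⁻¹ ≤ 1 := inv_le_one_of_one_le₀ h1
    gcongr
  -- The slope `L + 1` instead of `L` leaves a full `-E'` in `ψₜ + L|ψₓ|`. The last factor is 1 for
  -- `t ≥ -1` and makes the support compact.
  set ψ : ℝ × ℝ → ℝ := fun p =>
    E (R₂ - q p.1 - (L + 1) * p.2) * Real.smoothTransition (p.2 + 2) with hψ
  have hψs : ContDiff ℝ ∞ ψ :=
    (hEs.comp ((contDiff_const.sub (hqs.comp contDiff_fst)).sub (by fun_prop))).mul
      (Real.smoothTransition.contDiff.comp (by fun_prop))
  have hψd : Differentiable ℝ ψ := hψs.differentiable (by simp)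
  have hT : ∀ x t, 0 < t → dT ψ (x, t) = deriv E (R₂ - q x - (L + 1) * t) * -(L + 1) := by
    intro x t ht
    refine (hasDerivAt_slice_snd hψd x t).unique ?_
    have h1 : HasDerivAt (fun s => R₂ - q x - (L + 1) * s) (-(L + 1)) t := by
      simpa using ((hasDerivAt_id t).const_mul (L + 1)).const_sub (R₂ - q x)
    refine ((hEd _).comp t h1).congr_of_eventuallyEq ?_
    filter_upwards [lt_mem_nhds ht] with s hs
    simp only [hψ, Function.comp]
    rw [Real.smoothTransition.one_of_one_le (by linarith), mul_one]
  have hX : ∀ x t, 0 < t →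
      dX ψ (x, t) = deriv E (R₂ - q x - (L + 1) * t) * -(x / q x) := by
    intro x t ht
    refine (hasDerivAt_slice_fst hψd x t).unique ?_
    have h1 : HasDerivAt (fun y => R₂ - q y - (L + 1) * t) (-(x / q x)) x :=
      ((hqd x).const_sub R₂).sub_const _
    have h2 := (hEd (R₂ - q x - (L + 1) * t)).comp x h1
    refine h2.congr_of_eventuallyEq (Eventually.of_forall fun y => ?_)
    simp only [hψ, Function.comp]
    rw [Real.smoothTransition.one_of_one_le (by linarith), mul_one]
  have hkey : ∀ x t, 0 < t →
      dT ψ (x, t) + L * |dX ψ (x, t)| ≤ -deriv E (R₂ - q x - (L + 1) * t) := by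
    intro x t ht
    rw [hT x t ht, hX x t ht, abs_mul, abs_of_nonneg (hE' _), abs_neg, abs_div,
      abs_of_pos (hq0 x)]
    have h1 : |x| / q x ≤ 1 := (div_le_one (hq0 x)).2 (hqx x)
    nlinarith [mul_le_mul_of_nonneg_left h1 (mul_nonneg hL (hE' (R₂ - q x - (L + 1) * t)))]
  refine ⟨ψ, ⟨hψs, ?_⟩, fun p => mul_nonneg (expNegInvGlue.nonneg _)
    (Real.smoothTransition.nonneg _), fun p hp => ?_, Real.exp (-1) / R₂ ^ 2, by positivity,
    fun p hp hp2 => ?_⟩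
  · refine HasCompactSupport.intro
      (isCompact_closedBall (0 : ℝ × ℝ) (R₂ + 2 * (L + 1) + 2)) fun p hp => ?_
    by_contra hne
    refine hp ?_
    have h1 : 0 < p.2 + 2 := by
      by_contra h
      exact hne (by simp only [hψ, Real.smoothTransition.zero_of_nonpos (not_lt.1 h), mul_zero])
    have h2 : 0 < R₂ - q p.1 - (L + 1) * p.2 := by
      by_contra h
      exact hne (by simp only [hψ, hE, expNegInvGlue.zero_of_nonpos (not_lt.1 h), zero_mul])
    have h3 := hq0 p.1
    have h4 := hqx p.1
    rw [mem_closedBall_zero_iff, Prod.norm_def, Real.norm_eq_abs, Real.norm_eq_abs]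
    refine max_le (by nlinarith) (abs_le.2 ⟨by nlinarith, ?_⟩)
    by_contra hlt
    push Not at hlt
    nlinarith
  · exact (hkey p.1 p.2 hp).trans (neg_nonpos.2 (hE' _))
  · refine (hkey p.1 p.2 hp2).trans (neg_le_neg (hEc _ ?_ ?_))
    · rw [mem_closedBall_zero_iff, Prod.norm_def, Real.norm_eq_abs, Real.norm_eq_abs] at hp
      have h1 : |p.1| ≤ R₀ := (le_max_left _ _).trans hp
      have h2 : p.2 ≤ R₀ := (le_abs_self _).trans ((le_max_right _ _).trans hp)
      have h3 : q p.1 ≤ √(1 + R₀ ^ 2) := by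
        refine Real.sqrt_le_sqrt ?_
        have := sq_le_sq' (by linarith [abs_le.1 h1 |>.1]) (abs_le.1 h1).2
        linarith
      have h4 : (L + 1) * p.2 ≤ (L + 1) * R₀ := by gcongr
      rw [hR₂]
      linarith
    · have := hq0 p.1
      have : 0 ≤ (L + 1) * p.2 := by positivity
      linarith

/-! ### Kuznetsov's estimate of the doubled difference -/

theorem TestBound.mono {R C R' C' : ℝ} {φ : ℝ × ℝ → ℝ} (h : TestBound R C φ) (hR : R ≤ R')
    (hC : C ≤ C') : TestBound R' C' φ :=
  ⟨h.test, h.nonneg, fun p hp => h.supp p (hR.trans_lt hp), fun p => (h.le p).trans hC,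
    fun p q => (h.lip p q).trans (by gcongr), fun p q => (h.lipT p q).trans (by gcongr),
    fun p q => (h.lipX p q).trans (by gcongr)⟩

theorem hasDerivAt_line {E : Type*} [NormedAddCommGroup E] [NormedSpace ℝ E] {G : E → ℝ}
    (hG : Differentiable ℝ G) (z w : E) :
    HasDerivAt (fun s : ℝ => G (z + s • w)) (fderiv ℝ G z w) 0 :=
  (hG z).hasFDerivAt.hasLineDerivAt w

/-- The oscillation of the initial values at the scale of the mollifier `ρ`, weighted with the
trace of `ψ`. -/
def initialOscillation (a : ℝ → ℝ) (ψ : ℝ × ℝ → ℝ) (ρ : ℝ → ℝ) : ℝ :=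
  ∫ x, ψ (x, 0) * ∫ y, |a y - a x| * ρ (x - y)

/-- The mollification kernel in space-time. -/
def kernel (ρ θ : ℝ → ℝ) (z : (ℝ × ℝ) × (ℝ × ℝ)) : ℝ :=
  ρ (z.1.1 - z.2.1) * θ (z.2.2 - z.1.2)

theorem norm_le_of_kernel_ne_zero {ρ θ χ : ℝ → ℝ} {ε τ R : ℝ} (hρ : IsSpaceKernel ε ρ)
    (hθ : IsTimeKernel τ θ χ) (hτ : τ ≤ 1)
    {z : (ℝ × ℝ) × (ℝ × ℝ)} (hz : ‖z.1‖ ≤ R) (h : kernel ρ θ z ≠ 0) : ‖z‖ ≤ R + ε + 1 := by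
  have h1 : |z.1.1 - z.2.1| < ε := by
    by_contra hn
    exact h (by rw [kernel, hρ.zero_of_ge _ (not_lt.1 hn), zero_mul])
  have h2 : 0 < z.2.2 - z.1.2 := by
    by_contra hn
    exact h (by rw [kernel, hθ.zero_of_le _ (not_lt.1 hn), mul_zero])
  have h3 : z.2.2 - z.1.2 < τ := by
    by_contra hn
    exact h (by rw [kernel, hθ.zero_of_ge _ (not_lt.1 hn), mul_zero])
  rw [Prod.norm_def, Real.norm_eq_abs, Real.norm_eq_abs, max_le_iff] at hz
  rw [Prod.norm_def, Prod.norm_def, Prod.norm_def]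
  simp only [Real.norm_eq_abs]
  have ha := abs_le.1 hz.1
  have hb := abs_le.1 hz.2
  have hc := abs_lt.1 h1
  refine max_le (max_le ?_ ?_) (max_le ?_ ?_) <;> rw [abs_le] <;> constructor <;> linarith

theorem contDiff_kernel {ρ θ : ℝ → ℝ} (hρ : ContDiff ℝ ∞ ρ) (hθ : ContDiff ℝ ∞ θ) :
    ContDiff ℝ ∞ (kernel ρ θ) :=
  (hρ.comp (by fun_prop)).mul (hθ.comp (by fun_prop))

/-- The kernel depends only on differences of the two points, so it is constant along diagonal
directions `(w, w)`. Hence the large derivatives of the mollifiers never enter the interior terms.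
-/
theorem fderiv_weight_mul_kernel {ψ : ℝ × ℝ → ℝ} {ρ θ : ℝ → ℝ} (hψ : ContDiff ℝ ∞ ψ)
    (hρ : ContDiff ℝ ∞ ρ) (hθ : ContDiff ℝ ∞ θ) (z : (ℝ × ℝ) × (ℝ × ℝ)) (w : ℝ × ℝ) :
    fderiv ℝ (fun z : (ℝ × ℝ) × (ℝ × ℝ) => ψ z.1 * kernel ρ θ z) z (w, w) =
      fderiv ℝ ψ z.1 w * kernel ρ θ z := by
  have hd : Differentiable ℝ fun z : (ℝ × ℝ) × (ℝ × ℝ) => ψ z.1 * kernel ρ θ z :=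
    ((hψ.comp contDiff_fst).mul (contDiff_kernel hρ hθ)).differentiable (by simp)
  refine (hasDerivAt_line hd z (w, w)).unique ?_
  have h1 := (hasDerivAt_line (hψ.differentiable (by simp)) z.1 w).mul_const (kernel ρ θ z)
  refine h1.congr_of_eventuallyEq (Eventually.of_forall fun s => ?_)
  simp only [kernel, Prod.fst_add, Prod.snd_add, Prod.smul_fst, Prod.smul_snd,
    add_sub_add_right_eq_sub]

/-- The initial layer of an almost Kruzkov solution, compared with the level `a x`. -/
theorem initial_layer_le {f a : ℝ → ℝ} {M B : ℝ} (hf : Continuous f)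
    (hB : ∀ v, |v| ≤ M → |f v| ≤ B) (haM : ∀ x, |a x| ≤ M)
    {ψ : ℝ × ℝ → ℝ} (hψ0 : ∀ p, 0 ≤ ψ p) {P : ℝ}
    (hψP : ∀ p, ψ p ≤ P) {ρ : ℝ → ℝ} {ε : ℝ} (hε : 0 < ε) (hρ : IsSpaceKernel ε ρ) {D : ℝ}
    (hD : ∀ x, |deriv ρ x| ≤ D) {θ χ : ℝ → ℝ} {τ : ℝ} (hτ : 0 < τ)
    (hθ : IsTimeKernel τ θ χ) {R C e : ℝ} {x : ℝ}
    (hb : TestBound R C fun q : ℝ × ℝ => ψ (x, 0) * (ρ (x - q.1) * χ q.2))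
    {v : ℝ × ℝ → ℝ} (hv : Measurable v) (hvM : ∀ p, |v p| ≤ M)
    (hve : AlmostKruzkov f a M R C e v) :
    ∫ q in halfPlane, |a x - v q| * (ψ (x, 0) * kernel ρ θ ((x, 0), q)) ≤
      (ψ (x, 0) * ∫ y, |a y - a x| * ρ (x - y)) + 4 * B * P * D * ε * τ + e := by
  set φ : ℝ × ℝ → ℝ := fun q => ψ (x, 0) * (ρ (x - q.1) * χ q.2) with hφ
  have hB0 : 0 ≤ B := (abs_nonneg _).trans (hB _ (haM 0))
  have hP0 : 0 ≤ P := (hψ0 0).trans (hψP 0)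
  have hD0 : 0 ≤ D := (abs_nonneg _).trans (hD 0)
  have hφd : Differentiable ℝ φ := hb.test.differentiable
  -- For positive times `χ' = -θ`, so the time derivative reproduces, up to sign, the kernel in the
  -- integral to be bounded.
  have hT : ∀ q : ℝ × ℝ, 0 < q.2 → dT φ q = -(ψ (x, 0) * kernel ρ θ ((x, 0), q)) := by
    rintro ⟨y, s⟩ hs
    refine (hasDerivAt_slice_snd hφd y s).unique ?_
    have := ((hθ.hasDerivAt s hs).const_mul (ρ (x - y))).const_mul (ψ (x, 0))
    refine this.congr_deriv ?_
    simp only [kernel, sub_zero]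
    ring
  have hρd : ∀ y, HasDerivAt ρ (deriv ρ y) y := fun y =>
    (hρ.smooth.differentiable (by simp) y).hasDerivAt
  have hX : ∀ q : ℝ × ℝ, dX φ q = ψ (x, 0) * (-deriv ρ (x - q.1) * χ q.2) := by
    rintro ⟨y, s⟩
    refine (hasDerivAt_slice_fst hφd y s).unique ?_
    have h1 : HasDerivAt (fun y => x - y) (-1) y := (hasDerivAt_id y).const_sub x
    have := (((hρd (x - y)).comp y h1).mul_const (χ s)).const_mul (ψ (x, 0))
    refine this.congr_deriv ?_
    ring
  have hρ0 : ∀ y, ε ≤ |y| → deriv ρ y = 0 := fun y hy =>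
    IsLocalMin.deriv_eq_zero (Eventually.of_forall fun r => by
      rw [hρ.zero_of_ge y hy]; exact hρ.nonneg r)
  -- For positive times the space derivative of `φ` vanishes off this set of area `2ετ`. With the
  -- bound `2BPD` for the flux integrand this gives the error `4BPDετ`, which a small `τ` absorbs.
  set S : Set (ℝ × ℝ) := Icc (x - ε) (x + ε) ×ˢ Icc 0 τ with hS
  have hSm : MeasurableSet S := measurableSet_Icc.prod measurableSet_Icc
  have hSv : volume.real S = 2 * ε * τ := by
    rw [hS, Measure.volume_eq_prod, measureReal_prod_prod, Real.volume_real_Icc_of_le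
      (by linarith), Real.volume_real_Icc_of_le hτ.le]
    ring
  have hSf : volume S ≠ ⊤ := (isCompact_Icc.prod isCompact_Icc).measure_lt_top.ne
  have hXb : ∀ q : ℝ × ℝ, 0 < q.2 →
      |f (v q) - f (a x)| * dX φ q ≤ S.indicator (fun _ => 2 * B * P * D) q := by
    intro q hq
    by_cases hqS : q ∈ S
    · rw [indicator_of_mem hqS]
      have h1 : |f (v q) - f (a x)| ≤ 2 * B :=
        (abs_sub _ _).trans (by linarith [hB _ (hvM q), hB _ (haM x)])
      have h2 : dX φ q ≤ P * D := by
        rw [hX]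
        have h3 : -deriv ρ (x - q.1) * χ q.2 ≤ D := by
          calc _ ≤ |deriv ρ (x - q.1)| * χ q.2 :=
                mul_le_mul_of_nonneg_right (neg_le_abs _) (hθ.cutoff_nonneg _)
            _ ≤ D * 1 := mul_le_mul (hD _) (hθ.cutoff_le _) (hθ.cutoff_nonneg _) hD0
            _ = D := mul_one D
        calc _ ≤ ψ (x, 0) * D := mul_le_mul_of_nonneg_left h3 (hψ0 _)
          _ ≤ P * D := mul_le_mul_of_nonneg_right (hψP _) hD0
      calc _ ≤ |f (v q) - f (a x)| * (P * D) := mul_le_mul_of_nonneg_left h2 (abs_nonneg _)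
        _ ≤ 2 * B * (P * D) := mul_le_mul_of_nonneg_right h1 (by positivity)
        _ = 2 * B * P * D := by ring
    · rw [indicator_of_notMem hqS, hX]
      rcases le_or_gt τ q.2 with h | h
      · simp [hθ.cutoff_of_ge _ h]
      · have : ε ≤ |x - q.1| := by
          by_contra hn
          have := abs_lt.1 (not_le.1 hn)
          exact hqS ⟨⟨by linarith, by linarith⟩, hq.le, h.le⟩
        simp [hρ0 _ this]
  have hm1 := hb.test.continuous_dT.measurable
  have hm2 := hb.test.continuous_dX.measurable
  have hfm := hf.measurable
  have hi1 : IntegrableOn (fun q => |v q - a x| * dT φ q) halfPlane := by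
    refine (hb.test.integrable_dT.bdd_mul (c := M + M) (by fun_prop)
      (ae_of_all _ fun q => ?_)).integrableOn
    rw [Real.norm_eq_abs, abs_abs]
    exact (abs_sub _ _).trans (add_le_add (hvM _) (haM _))
  have hi2 : IntegrableOn (fun q => |f (v q) - f (a x)| * dX φ q) halfPlane := by
    refine (hb.test.integrable_dX.bdd_mul (c := B + B) (by fun_prop)
      (ae_of_all _ fun q => ?_)).integrableOn
    rw [Real.norm_eq_abs, abs_abs]
    exact (abs_sub _ _).trans (add_le_add (hB _ (hvM _)) (hB _ (haM _)))
  have hmain := hve (a x) (haM x) φ hb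
  rw [weakForm, integral_add hi1 hi2] at hmain
  have e1 : ∫ q in halfPlane, |v q - a x| * dT φ q =
      -∫ q in halfPlane, |a x - v q| * (ψ (x, 0) * kernel ρ θ ((x, 0), q)) := by
    rw [← integral_neg]
    refine setIntegral_congr_fun measurableSet_halfPlane fun q hq => ?_
    simp only [hT q hq, abs_sub_comm (a x)]
    ring
  have e2 : ∫ q in halfPlane, |f (v q) - f (a x)| * dX φ q ≤ 4 * B * P * D * ε * τ := by
    have hii : IntegrableOn (S.indicator fun _ => 2 * B * P * D) halfPlane :=
      ((integrable_indicator_iff hSm).2 (integrableOn_const hSf)).integrableOn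
    calc _ ≤ ∫ q in halfPlane, S.indicator (fun _ => 2 * B * P * D) q :=
          setIntegral_mono_on hi2 hii measurableSet_halfPlane hXb
      _ ≤ ∫ q, S.indicator (fun _ => 2 * B * P * D) q := by
          refine setIntegral_le_integral ((integrable_indicator_iff hSm).2
            (integrableOn_const hSf)) (ae_of_all _ fun q => ?_)
          exact indicator_nonneg (fun _ _ => by positivity) q
      _ = 4 * B * P * D * ε * τ := by
          rw [integral_indicator hSm, setIntegral_const, hSv, smul_eq_mul]
          ring
  have e3 : ∫ y, |a y - a x| * φ (y, 0) = ψ (x, 0) * ∫ y, |a y - a x| * ρ (x - y) := by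
    rw [← integral_const_mul]
    refine integral_congr_ae (ae_of_all _ fun y => ?_)
    simp only [hφ, hθ.cutoff_zero]
    ring
  rw [e1, e3] at hmain
  linarith

/-- The doubled difference of two almost Kruzkov solutions is controlled by the oscillation of
the initial values. -/
theorem kuznetsov_estimate {f a : ℝ → ℝ} {M L B : ℝ} (hf : Continuous f)
    (hfL : ∀ v w, |v| ≤ M → |w| ≤ M → |f v - f w| ≤ L * |v - w|)
    (hB : ∀ v, |v| ≤ M → |f v| ≤ B) (ha : Measurable a) (haM : ∀ x, |a x| ≤ M)
    {ψ : ℝ × ℝ → ℝ} (hψ : IsTestFunction ψ) (hψ0 : ∀ p, 0 ≤ ψ p) {P Rψ : ℝ}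
    (hψP : ∀ p, ψ p ≤ P) (hψR : ∀ p, Rψ < ‖p‖ → ψ p = 0) (hRψ : 0 ≤ Rψ)
    {ρ : ℝ → ℝ} {ε : ℝ} (hε : 0 < ε) (hρ : IsSpaceKernel ε ρ) {D : ℝ}
    (hD : ∀ x, |deriv ρ x| ≤ D) {θ χ : ℝ → ℝ} {τ : ℝ} (hτ : 0 < τ) (hτ1 : τ ≤ 1)
    (hθ : IsTimeKernel τ θ χ) :
    ∃ R C E, 0 ≤ E ∧ ∀ e, 0 ≤ e → ∀ u v : ℝ × ℝ → ℝ, Measurable u → Measurable v →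
      (∀ p, |u p| ≤ M) → (∀ p, |v p| ≤ M) → AlmostKruzkov f a M R C e u →
      AlmostKruzkov f a M R C e v →
      ∫ z, |u z.1 - v z.2| * (-(dT ψ z.1 + L * |dX ψ z.1|) * kernel ρ θ z)
        ∂((volume.restrict halfPlane).prod (volume.restrict halfPlane)) ≤
      initialOscillation a ψ ρ + 2 * Rψ * (4 * B * P * D * ε * τ) + E * e := by
  obtain ⟨G1s, G1c, G1n⟩ : ContDiff ℝ ∞ (fun z : (ℝ × ℝ) × (ℝ × ℝ) => ψ z.1 * kernel ρ θ z) ∧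
      HasCompactSupport (fun z : (ℝ × ℝ) × (ℝ × ℝ) => ψ z.1 * kernel ρ θ z) ∧
      ∀ z : (ℝ × ℝ) × (ℝ × ℝ), 0 ≤ ψ z.1 * kernel ρ θ z := by
    refine ⟨(hψ.1.comp contDiff_fst).mul (contDiff_kernel hρ.smooth hθ.smooth),
      HasCompactSupport.intro (isCompact_closedBall 0 (Rψ + ε + 1)) fun z hz => ?_,
      fun z => mul_nonneg (hψ0 _) (mul_nonneg (hρ.nonneg _) (hθ.nonneg _))⟩
    by_contra hne
    refine hz (mem_closedBall_zero_iff.2 (norm_le_of_kernel_ne_zero hρ hθ hτ1 ?_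
      (right_ne_zero_of_mul hne)))
    by_contra hlt
    exact hne (by simp only [hψR _ (not_le.1 hlt), zero_mul])
  set G : (ℝ × ℝ) × (ℝ × ℝ) → ℝ := fun z => ψ z.1 * kernel ρ θ z with hG
  -- Its slices at first points `(x, 0)` are the test functions of `initial_layer_le`.
  set G' : (ℝ × ℝ) × (ℝ × ℝ) → ℝ := fun z => ψ z.1 * (ρ (z.1.1 - z.2.1) * χ z.2.2) with hG'
  have G2s : ContDiff ℝ ∞ G' :=
    (hψ.1.comp contDiff_fst).mul ((hρ.smooth.comp (by fun_prop)).mul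
      (hθ.cutoff_smooth.comp (by fun_prop)))
  have G2c : HasCompactSupport G' := by
    refine HasCompactSupport.intro (isCompact_closedBall 0 (Rψ + ε + 2)) fun z hz => ?_
    by_contra hne
    refine hz (mem_closedBall_zero_iff.2 ?_)
    have h0 : ‖z.1‖ ≤ Rψ := by
      by_contra hlt
      exact hne (by simp only [hG', hψR _ (not_le.1 hlt), zero_mul])
    have h1 : |z.1.1 - z.2.1| < ε := by
      by_contra hn
      exact hne (by simp only [hG', hρ.zero_of_ge _ (not_lt.1 hn), zero_mul, mul_zero])
    have h2 : z.2.2 < τ := by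
      by_contra hn
      exact hne (by simp only [hG', hθ.cutoff_of_ge _ (not_lt.1 hn), mul_zero])
    have h3 : -2 < z.2.2 := by
      by_contra hn
      exact hne (by simp only [hG', hθ.cutoff_of_le _ (not_lt.1 hn), mul_zero])
    have h4 := abs_le.1 ((le_max_left _ _).trans h0)
    have hc := abs_lt.1 h1
    rw [Prod.norm_def]
    refine max_le (h0.trans (by linarith)) ?_
    rw [Prod.norm_def, Real.norm_eq_abs, Real.norm_eq_abs]
    refine max_le ?_ ?_ <;> rw [abs_le] <;> constructor <;> linarith
  have G2n : ∀ z, 0 ≤ G' z := fun z =>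
    mul_nonneg (hψ0 _) (mul_nonneg (hρ.nonneg _) (hθ.cutoff_nonneg _))
  obtain ⟨R1, C1, hR1, hC1, hp, hq, hz, hz'⟩ := exists_testBound_slices G1s G1c G1n
  obtain ⟨R2, C2, hR2, hC2, -, hq2, -, -⟩ := exists_testBound_slices G2s G2c G2n
  have hle1 : R1 ≤ max R1 R2 := le_max_left _ _
  have hle2 : C1 ≤ max C1 C2 := le_max_left _ _
  -- The coefficient of `e` collects two integrations over a ball from the doubling and the initial
  -- layer integrated over `|x| ≤ Rψ`.
  refine ⟨max R1 R2, max C1 C2,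
    2 * volume.real (closedBall (0 : ℝ × ℝ) (max R1 R2)) + 2 * Rψ, by positivity, ?_⟩
  intro e he u v hu hv huM hvM hue hve
  have hfm := hf.measurable
  -- When the second time is 0 and the first is positive, the argument of `θ` is negative, so `G`
  -- vanishes.
  have hBC := doubling_inequality hf ha haM G1s G1c (fun p hp0 y => by
      simp only [hG, kernel]
      rw [hθ.zero_of_le _ (by linarith)]
      ring) (fun q => (hp q).mono hle1 hle2) (fun p => (hq p).mono hle1 hle2)
    (fun z h => hz z (hle1.trans_lt h)) (fun z h => hz' z (hle1.trans_lt h)) hu hv huM hvM he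
    hue hve
  set μ : Measure (ℝ × ℝ) := volume.restrict halfPlane with hμ
  set I0 := ∫ q, (∫ x, |a x - v q| * G ((x, 0), q)) ∂μ with hI0
  have hball : ∀ z : (ℝ × ℝ) × (ℝ × ℝ), z ∉ closedBall 0 R1 → R1 < ‖z‖ := fun z h => by
    simpa using h
  have hfin : (μ.prod μ) (closedBall 0 R1) ≠ ⊤ :=
    (isCompact_closedBall (0 : (ℝ × ℝ) × (ℝ × ℝ)) R1).measure_lt_top.ne
  have hLM : ∀ z : (ℝ × ℝ) × (ℝ × ℝ), |u z.1 - v z.2| ≤ M + M := fun z =>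
    (abs_sub _ _).trans (add_le_add (huM _) (hvM _))
  have hDm : ∀ w, Measurable fun z => fderiv ℝ G z w := fun w =>
    ((G1s.continuous_fderiv (by simp)).clm_apply continuous_const).measurable
  have hDb : ∀ w, ∃ D, ∀ z, |fderiv ℝ G z w| ≤ D := fun w =>
    ((G1c.fderiv ℝ).comp_left (g := fun A : (ℝ × ℝ) × (ℝ × ℝ) →L[ℝ] ℝ => A w)
      (by simp)).exists_bound_of_continuous
      ((G1s.continuous_fderiv (by simp)).clm_apply continuous_const)
  have hInt : ∀ (g : (ℝ × ℝ) × (ℝ × ℝ) → ℝ) (B' : ℝ) (w), Measurable g → (∀ z, |g z| ≤ B') →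
      Integrable (fun z => g z * fderiv ℝ G z w) (μ.prod μ) := by
    intro g B' w hg hgB
    obtain ⟨D', hD'⟩ := hDb w
    have := hDm w
    refine integrable_of_bound_of_support (B := B' * D') (by fun_prop) hfin (fun z => ?_)
      (fun z h => by simp [hz' z (hball z h)])
    rw [abs_mul]
    exact mul_le_mul (hgB z) (hD' z) (abs_nonneg _) ((abs_nonneg _).trans (hgB z))
  have hDT : ∀ z, fderiv ℝ G z ((0, 1), (0, 1)) = dT ψ z.1 * kernel ρ θ z := fun z =>
    fderiv_weight_mul_kernel hψ.1 hρ.smooth hθ.smooth z (0, 1)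
  have hDX : ∀ z, fderiv ℝ G z ((1, 0), (1, 0)) = dX ψ z.1 * kernel ρ θ z := fun z =>
    fderiv_weight_mul_kernel hψ.1 hρ.smooth hθ.smooth z (1, 0)
  have hK0 : ∀ z, 0 ≤ kernel ρ θ z := fun z => mul_nonneg (hρ.nonneg _) (hθ.nonneg _)
  have hi1 := hInt (fun z => |u z.1 - v z.2|) (M + M) ((0, 1), (0, 1)) (by fun_prop)
    (fun z => by rw [abs_abs]; exact hLM z)
  have hi2 := hInt (fun z => |f (u z.1) - f (v z.2)|) (B + B) ((1, 0), (1, 0)) (by fun_prop)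
    (fun z => by
      rw [abs_abs]
      exact (abs_sub _ _).trans (add_le_add (hB _ (huM _)) (hB _ (hvM _))))
  have hi3 := (hInt (fun z => |u z.1 - v z.2|) (M + M) ((1, 0), (1, 0)) (by fun_prop)
    (fun z => by rw [abs_abs]; exact hLM z)).norm
  -- The Lipschitz bound trades the flux difference for `L|u - v|`, which merges both terms into the
  -- cone weight.
  have hmono : (∫ z, (|u z.1 - v z.2| * fderiv ℝ G z ((0, 1), (0, 1)) +
          |f (u z.1) - f (v z.2)| * fderiv ℝ G z ((1, 0), (1, 0))) ∂(μ.prod μ)) ≤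
      -∫ z, |u z.1 - v z.2| * (-(dT ψ z.1 + L * |dX ψ z.1|) * kernel ρ θ z) ∂(μ.prod μ) := by
    rw [← integral_neg]
    have hrew : (fun z : (ℝ × ℝ) × (ℝ × ℝ) =>
        -(|u z.1 - v z.2| * (-(dT ψ z.1 + L * |dX ψ z.1|) * kernel ρ θ z))) = fun z =>
        |u z.1 - v z.2| * fderiv ℝ G z ((0, 1), (0, 1)) +
          L * ‖|u z.1 - v z.2| * fderiv ℝ G z ((1, 0), (1, 0))‖ := by
      funext z
      rw [hDT, hDX, Real.norm_eq_abs, abs_mul, abs_abs, abs_mul, abs_of_nonneg (hK0 z)]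
      ring
    rw [hrew]
    refine integral_mono (hi1.add hi2) (hi1.add (hi3.const_mul L)) fun z => ?_
    refine add_le_add le_rfl ?_
    calc _ ≤ |f (u z.1) - f (v z.2)| * |fderiv ℝ G z ((1, 0), (1, 0))| :=
          mul_le_mul_of_nonneg_left (le_abs_self _) (abs_nonneg _)
      _ ≤ L * |u z.1 - v z.2| * |fderiv ℝ G z ((1, 0), (1, 0))| :=
          mul_le_mul_of_nonneg_right (hfL _ _ (huM _) (hvM _)) (abs_nonneg _)
      _ = _ := by rw [Real.norm_eq_abs, abs_mul, abs_abs, mul_assoc]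
  have hI0le : I0 ≤ initialOscillation a ψ ρ + 2 * Rψ * (4 * B * P * D * ε * τ) + 2 * Rψ * e := by
    have hGm : Measurable G := G1s.continuous.measurable
    have hi : Integrable (fun z : (ℝ × ℝ) × ℝ => |a z.2 - v z.1| * G ((z.2, 0), z.1))
        (μ.prod volume) := by
      obtain ⟨D', hD'⟩ := G1c.exists_bound_of_continuous G1s.continuous
      refine integrable_of_bound_of_support (B := (M + M) * D') (s := closedBall 0 R1)
        (by fun_prop) (isCompact_closedBall (0 : (ℝ × ℝ) × ℝ) R1).measure_lt_top.ne
        (fun z => ?_) (fun z h => ?_)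
      · rw [abs_mul, abs_abs]
        have := (abs_sub (a z.2) (v z.1)).trans (add_le_add (haM _) (hvM _))
        exact mul_le_mul this (hD' _) (abs_nonneg _) ((abs_nonneg _).trans this)
      · rw [hz, mul_zero]
        have h' : R1 < ‖z‖ := by simpa using h
        refine h'.trans_le ?_
        simp only [Prod.norm_def, norm_zero]
        refine max_le (le_max_right _ _) ((le_max_left _ _).trans (le_max_left _ _))
    rw [hI0, integral_integral_swap hi]
    have hosc : Integrable (fun x => ψ (x, 0) * ∫ y, |a y - a x| * ρ (x - y)) := by
      have hψm := hψ.1.continuous.measurable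
      have hρm := hρ.smooth.continuous.measurable
      have h2 : Integrable (fun z : ℝ × ℝ => ψ (z.1, 0) * (|a z.2 - a z.1| * ρ (z.1 - z.2)))
          (volume.prod volume) := by
        refine integrable_of_bound_of_support (B := P * ((M + M) * (1 / ε)))
          (s := closedBall 0 (Rψ + ε)) (by fun_prop)
          (isCompact_closedBall (0 : ℝ × ℝ) (Rψ + ε)).measure_lt_top.ne
          (fun z => ?_) (fun z h => ?_)
        · have h3 := (abs_sub (a z.2) (a z.1)).trans (add_le_add (haM _) (haM _))
          rw [abs_mul, abs_mul, abs_abs, abs_of_nonneg (hψ0 _), abs_of_nonneg (hρ.nonneg _)]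
          refine mul_le_mul (hψP _) (mul_le_mul h3 (hρ.le _) (hρ.nonneg _)
            ((abs_nonneg _).trans h3)) (mul_nonneg (abs_nonneg _) (hρ.nonneg _))
            ((hψ0 0).trans (hψP 0))
        · by_contra hne
          have h1 : |z.1 - z.2| < ε := by
            by_contra hn
            exact hne (by rw [hρ.zero_of_ge _ (not_lt.1 hn), mul_zero, mul_zero])
          have h2 : ‖((z.1, 0) : ℝ × ℝ)‖ ≤ Rψ := by
            by_contra hn
            exact hne (by rw [hψR _ (not_le.1 hn), zero_mul])
          have h4 := abs_le.1 ((le_max_left _ _).trans h2)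
          have hc := abs_lt.1 h1
          simp only at h4
          refine h (mem_closedBall_zero_iff.2 ?_)
          rw [Prod.norm_def, Real.norm_eq_abs, Real.norm_eq_abs]
          refine max_le ?_ ?_ <;> rw [abs_le] <;> constructor <;> linarith
      simpa only [integral_const_mul] using h2.integral_prod_left
    set c := 4 * B * P * D * ε * τ + e with hc
    have hci : Integrable (indicator (Icc (-Rψ) Rψ) fun _ : ℝ => c) :=
      (integrable_indicator_iff measurableSet_Icc).2
        (integrableOn_const (isCompact_Icc.measure_lt_top.ne))
    calc _ ≤ ∫ x, ((ψ (x, 0) * ∫ y, |a y - a x| * ρ (x - y)) +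
            indicator (Icc (-Rψ) Rψ) (fun _ => c) x) := by
          refine integral_mono hi.swap.integral_prod_left (hosc.add hci) fun x => ?_
          by_cases hx : x ∈ Icc (-Rψ) Rψ
          · have := initial_layer_le hf hB haM hψ0 hψP hε hρ hD hτ hθ
              ((hq2 (x, 0)).mono (le_max_right R1 R2) (le_max_right C1 C2)) hv hvM hve
            simp only [indicator_of_mem hx]
            rw [hc, ← add_assoc]
            exact this
          · have h0 : ψ (x, 0) = 0 := by
              refine hψR _ (lt_of_not_ge fun hle => hx ?_)
              exact abs_le.1 ((le_max_left _ _).trans hle)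
            simp [indicator_of_notMem hx, hG, h0]
      _ = _ := by
          rw [integral_add hosc hci, integral_indicator measurableSet_Icc, setIntegral_const,
            Real.volume_real_Icc_of_le (by linarith), initialOscillation, smul_eq_mul, hc]
          ring
  nlinarith [hBC, hmono, hI0le]

/-! ### Removal of the doubling and L¹ stability -/

theorem measurable_kernel {ρ θ χ : ℝ → ℝ} {ε τ : ℝ} (hρ : IsSpaceKernel ε ρ)
    (hθ : IsTimeKernel τ θ χ) : Measurable (kernel ρ θ) :=
  (contDiff_kernel hρ.smooth hθ.smooth).continuous.measurable

/-- Since `θ` lives at positive `s - t`, the second point is in the half-plane as soon as the first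
is, and no mass is lost at `t = 0`. -/
theorem integral_kernel {ρ θ χ : ℝ → ℝ} {ε τ : ℝ} (hρ : IsSpaceKernel ε ρ)
    (hθ : IsTimeKernel τ θ χ) {p : ℝ × ℝ} (hp : 0 < p.2) :
    ∫ q in halfPlane, kernel ρ θ (p, q) = 1 := by
  rw [setIntegral_eq_integral_of_forall_compl_eq_zero fun q hq => ?_]
  · simp only [kernel]
    rw [Measure.volume_eq_prod, integral_prod_mul (fun y => ρ (p.1 - y)) (fun s => θ (s - p.2)),
      integral_sub_left_eq_self ρ, integral_sub_right_eq_self θ, hρ.integral, hθ.integral, one_mul]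
  · have : ¬ 0 < q.2 := hq
    simp only [kernel]
    rw [hθ.zero_of_le _ (by linarith), mul_zero]

/-- The initial oscillation can be made arbitrarily small. -/
theorem exists_initialOscillation_le {a : ℝ → ℝ} {M : ℝ} (ha : Measurable a)
    (haM : ∀ x, |a x| ≤ M) {ψ : ℝ × ℝ → ℝ} (hψ : Continuous ψ) (hψ0 : ∀ p, 0 ≤ ψ p) {P Rψ : ℝ}
    (hψP : ∀ p, ψ p ≤ P) (hψR : ∀ p, Rψ < ‖p‖ → ψ p = 0) {κ : ℝ} (hκ : 0 < κ) :
    ∃ ε ρ, 0 < ε ∧ IsSpaceKernel ε ρ ∧ initialOscillation a ψ ρ ≤ κ := by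
  have hM0 : 0 ≤ M := (abs_nonneg _).trans (haM 0)
  have hP0 : 0 ≤ P := (hψ0 0).trans (hψP 0)
  set ε : ℕ → ℝ := fun n => 1 / ((n : ℝ) + 1) with hε
  have hεpos : ∀ n, 0 < ε n := fun n => Nat.one_div_pos_of_nat
  have hεlim : Tendsto ε atTop (𝓝[>] 0) :=
    tendsto_nhdsWithin_iff.2 ⟨tendsto_one_div_add_atTop_nhds_zero_nat,
      Eventually.of_forall hεpos⟩
  choose ρ hρ using fun n => exists_isSpaceKernel (hεpos n)
  have hψm := hψ.measurable
  have hmeas : ∀ n, Measurable fun z : ℝ × ℝ => |a z.2 - a z.1| * ρ n (z.1 - z.2) := fun n => by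
    have := (hρ n).smooth.continuous.measurable
    fun_prop
  have hle : ∀ n x y, |a y - a x| * ρ n (x - y) ≤ (M + M) * ρ n (x - y) := fun n x y =>
    mul_le_mul_of_nonneg_right ((abs_sub _ _).trans (add_le_add (haM _) (haM _)))
      ((hρ n).nonneg _)
  have hρi : ∀ n x, Integrable fun y => ρ n (x - y) := fun n x => by
    by_contra h
    have := integral_undef h
    rw [integral_sub_left_eq_self (ρ n), (hρ n).integral] at this
    exact one_ne_zero this
  have hnn : ∀ n x, 0 ≤ ∫ y, |a y - a x| * ρ n (x - y) := fun n x =>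
    integral_nonneg fun y => mul_nonneg (abs_nonneg _) ((hρ n).nonneg _)
  have hbd : ∀ n x, ∫ y, |a y - a x| * ρ n (x - y) ≤ M + M := fun n x => by
    calc _ ≤ ∫ y, (M + M) * ρ n (x - y) :=
          integral_mono_of_nonneg (ae_of_all _ fun y => mul_nonneg (abs_nonneg _)
            ((hρ n).nonneg _)) ((hρi n x).const_mul _) (ae_of_all _ fun y => hle n x y)
      _ = M + M := by
          rw [integral_const_mul, integral_sub_left_eq_self (ρ n), (hρ n).integral, mul_one]
  have hloc : LocallyIntegrable a := by
    intro x
    exact ⟨closedBall x 1, closedBall_mem_nhds x one_pos,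
      Measure.integrableOn_of_bounded (M := M) measure_closedBall_lt_top.ne
        ha.aestronglyMeasurable (ae_of_all _ haM)⟩
  -- At a Lebesgue point: `ρ ≤ 1/ε` on an interval of length `2ε`, so the mollified oscillation is
  -- at most twice the average one.
  have hpt : ∀ᵐ x, Tendsto (fun n => ∫ y, |a y - a x| * ρ n (x - y)) atTop (𝓝 0) := by
    filter_upwards [IsUnifLocDoublingMeasure.ae_tendsto_average_norm_sub volume hloc 1] with x hx
    have h1 := hx (fun _ : ℕ => x) ε hεlim (Eventually.of_forall fun n =>
      mem_closedBall_self (by simpa using (hεpos n).le))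
    have h2 := h1.const_mul 2
    rw [mul_zero] at h2
    refine squeeze_zero (fun n => hnn n x) (fun n => ?_) h2
    rw [setAverage_eq, Real.volume_real_closedBall (hεpos n).le, smul_eq_mul,
      ← integral_const_mul, ← integral_const_mul,
      ← integral_indicator measurableSet_closedBall]
    refine integral_mono_of_nonneg (ae_of_all _ fun y => mul_nonneg (abs_nonneg _)
      ((hρ n).nonneg _)) ?_ (ae_of_all _ fun y => ?_)
    · refine (integrable_indicator_iff measurableSet_closedBall).2
        (Measure.integrableOn_of_bounded (M := 2 * ((2 * ε n)⁻¹ * (M + M)))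
          measure_closedBall_lt_top.ne (by fun_prop) (ae_of_all _ fun y => ?_))
      have hp := hεpos n
      rw [norm_mul, norm_mul, norm_norm, Real.norm_of_nonneg (by norm_num : (0 : ℝ) ≤ 2),
        Real.norm_of_nonneg (by positivity)]
      gcongr
      exact (abs_sub _ _).trans (add_le_add (haM _) (haM _))
    · by_cases hy : y ∈ closedBall x (ε n)
      · simp only [indicator_of_mem hy]
        have hp := hεpos n
        have : 2 * ((2 * ε n)⁻¹ * ‖a y - a x‖) = |a y - a x| * (1 / ε n) := by
          rw [Real.norm_eq_abs]
          field_simp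
        rw [this]
        exact mul_le_mul_of_nonneg_left ((hρ n).le _) (abs_nonneg _)
      · simp only [indicator_of_notMem hy]
        rw [mem_closedBall, Real.dist_eq, abs_sub_comm, not_le] at hy
        rw [(hρ n).zero_of_ge _ hy.le, mul_zero]
  have hlim : Tendsto (fun n => initialOscillation a ψ (ρ n)) atTop (𝓝 (∫ _ : ℝ, (0 : ℝ))) := by
    refine tendsto_integral_of_dominated_convergence
      (indicator (Icc (-Rψ) Rψ) fun _ => P * (M + M)) (fun n => ?_) ?_ (fun n => ?_) ?_
    · exact (by fun_prop : Measurable fun x : ℝ => ψ (x, 0)).aestronglyMeasurable.mul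
        ((hmeas n).stronglyMeasurable.integral_prod_right (ν := volume)).aestronglyMeasurable
    · exact (integrable_indicator_iff measurableSet_Icc).2
        (integrableOn_const isCompact_Icc.measure_lt_top.ne)
    · refine ae_of_all _ fun x => ?_
      by_cases hx : x ∈ Icc (-Rψ) Rψ
      · rw [indicator_of_mem hx, norm_mul, Real.norm_of_nonneg (hψ0 _),
          Real.norm_of_nonneg (hnn n x)]
        exact mul_le_mul (hψP _) (hbd n x) (hnn n x) hP0
      · have h0 : ψ (x, 0) = 0 := hψR _ (lt_of_not_ge fun hle =>
          hx (abs_le.1 ((le_max_left _ _).trans hle)))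
        simp [indicator_of_notMem hx, h0]
    · filter_upwards [hpt] with x hx
      simpa using hx.const_mul (ψ (x, 0))
  rw [integral_zero] at hlim
  obtain ⟨n, hn⟩ := (hlim.eventually (gt_mem_nhds hκ)).exists
  exact ⟨ε n, ρ n, hεpos n, hρ n, hn.le⟩

/-- Two almost Kruzkov solutions with the same initial values are close to each other in
`L¹_loc`. -/
theorem exists_almostKruzkov_stability {f a : ℝ → ℝ} {M : ℝ} (hf : ContDiff ℝ ∞ f)
    (ha : Measurable a) (haM : ∀ x, |a x| ≤ M) (R₀ : ℝ) {η : ℝ} (hη : 0 < η) :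
    ∃ R C e, 0 < e ∧ ∀ u v : ℝ × ℝ → ℝ, Measurable u → Measurable v →
      (∀ p, |u p| ≤ M) → (∀ p, |v p| ≤ M) → AlmostKruzkov f a M R C e u →
      AlmostKruzkov f a M R C e v →
      ∫ p in halfPlane ∩ closedBall 0 R₀, |u p - v p| ≤ η := by
  obtain ⟨B, hB0, hB⟩ := exists_bound_on_Icc hf.continuous M
  obtain ⟨L, hL0, hL⟩ := exists_bound_on_Icc (hf.continuous_deriv (by simp)) M
  have hfL : ∀ v w, |v| ≤ M → |w| ≤ M → |f v - f w| ≤ L * |v - w| := fun v w hv hw =>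
    (convex_Icc (-M) M).norm_image_sub_le_of_norm_deriv_le
      (fun x _ => hf.differentiable (by simp) x) (fun x hx => hL x (abs_le.2 hx))
      (abs_le.1 hw) (abs_le.1 hv)
  obtain ⟨ψ, hψ, hψ0, hψH, c, hc, hψc⟩ := exists_cone_weight hL0 (le_max_right R₀ 0)
  obtain ⟨Rψ, hRψ, hR⟩ := hψ.2.isBounded.subset_closedBall_lt 0 0
  have hψt : ∀ p, Rψ < ‖p‖ → p ∉ tsupport ψ := fun p hp hmem => by
    have := mem_closedBall_zero_iff.1 (hR hmem)
    linarith
  have hψR : ∀ p, Rψ < ‖p‖ → ψ p = 0 := fun p hp => image_eq_zero_of_notMem_tsupport (hψt p hp)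
  have hψR' : ∀ p, Rψ < ‖p‖ → fderiv ℝ ψ p = 0 := fun p hp => by
    by_contra hne
    exact hψt p hp (support_fderiv_subset ℝ hne)
  obtain ⟨P, hP⟩ := hψ.2.exists_bound_of_continuous hψ.1.continuous
  have hψP : ∀ p, ψ p ≤ P := fun p => (le_abs_self _).trans (hP p)
  -- Each of the pairs `(u, v)` and `(v, v)` contributes three errors of size `κ`: initial
  -- oscillation, initial layer, and defect `e`. Dividing by the lower bound `c` of the weight
  -- leaves `η`.
  set κ := c * η / 6 with hκ
  have hκ0 : 0 < κ := by positivity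
  obtain ⟨ε, ρ, hε, hρ, hosc⟩ :=
    exists_initialOscillation_le ha haM hψ.1.continuous hψ0 hψP hψR hκ0
  have hρc : HasCompactSupport ρ := HasCompactSupport.intro (isCompact_closedBall 0 ε)
    fun x hx => hρ.zero_of_ge x (by
      rw [mem_closedBall_zero_iff, not_le] at hx
      exact hx.le)
  obtain ⟨D, hD⟩ := hρc.deriv.exists_bound_of_continuous (hρ.smooth.continuous_deriv (by simp))
  have hD0 : 0 ≤ D := (norm_nonneg _).trans (hD 0)
  have hP0 : 0 ≤ P := (norm_nonneg _).trans (hP 0)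
  set X := 2 * Rψ * (4 * B * P * D * ε) with hX
  have hX0 : 0 ≤ X := by positivity
  -- `τ` is chosen after `ρ`, because the layer error contains the bound `D` of `ρ'`; the admissible
  -- defect `e` is chosen last.
  set τ := min 1 (κ / (X + 1)) with hτ
  have hτ0 : 0 < τ := by positivity
  have hXτ : X * τ ≤ κ := by
    calc X * τ ≤ (X + 1) * (κ / (X + 1)) := by
          gcongr
          · linarith
          · exact min_le_right _ _
      _ = κ := by field_simp
  obtain ⟨θ, χ, hθ⟩ := exists_isTimeKernel hτ0
  obtain ⟨R, C, E, hE, hest⟩ := kuznetsov_estimate hf.continuous hfL hB ha haM hψ hψ0 hψP hψR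
    hRψ.le hε hρ hD hτ0 (min_le_left _ _) hθ
  refine ⟨R, C, κ / (E + 1), by positivity, fun u v hu hv huM hvM hue hve => ?_⟩
  have hEe : E * (κ / (E + 1)) ≤ κ := by
    calc _ ≤ (E + 1) * (κ / (E + 1)) := by gcongr; linarith
      _ = κ := by field_simp
  have h1 := hest _ (by positivity) u v hu hv huM hvM hue hve
  -- The estimate of `v` against itself takes the place of a modulus of continuity in L¹.
  have h2 := hest _ (by positivity) v v hv hv hvM hvM hve hve
  set μ : Measure (ℝ × ℝ) := volume.restrict halfPlane with hμ
  set W : ℝ × ℝ → ℝ := fun p => -(dT ψ p + L * |dX ψ p|) with hW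
  have hWc : Continuous W := (hψ.continuous_dT.add (hψ.continuous_dX.abs.const_mul L)).neg
  have hW0 : ∀ p, Rψ < ‖p‖ → W p = 0 := fun p hp => by simp [hW, dT, dX, hψR' p hp]
  obtain ⟨Ω, hΩ⟩ := (HasCompactSupport.intro (f := W) (isCompact_closedBall 0 Rψ) fun p hp =>
    hW0 p (by simpa using hp)).exists_bound_of_continuous hWc
  have hkm := measurable_kernel hρ hθ
  obtain ⟨T, hT⟩ : ∃ T, ∀ s, ‖θ s‖ ≤ T :=
    (HasCompactSupport.intro (isCompact_Icc (a := 0) (b := τ)) fun s hs => by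
      rcases le_total s 0 with h | h
      · exact hθ.zero_of_le s h
      · exact hθ.zero_of_ge s (le_of_not_ge fun h' => hs ⟨h, h'⟩)).exists_bound_of_continuous
      hθ.smooth.continuous
  have hk0 : ∀ z, 0 ≤ kernel ρ θ z := fun z => mul_nonneg (hρ.nonneg _) (hθ.nonneg _)
  have hkb : ∀ z, kernel ρ θ z ≤ 1 / ε * T := fun z =>
    mul_le_mul (hρ.le _) ((le_abs_self _).trans (hT _)) (hθ.nonneg _) (by positivity)
  have hWm := hWc.measurable
  have hint : ∀ g : (ℝ × ℝ) × (ℝ × ℝ) → ℝ, Measurable g → (∀ z, |g z| ≤ M + M) →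
      Integrable (fun z => |g z| * (W z.1 * kernel ρ θ z)) (μ.prod μ) := by
    intro g hg hgM
    refine integrable_of_bound_of_support (B := (M + M) * (Ω * (1 / ε * T)))
      (s := closedBall 0 (Rψ + ε + 1)) (by fun_prop)
      (isCompact_closedBall (0 : (ℝ × ℝ) × (ℝ × ℝ)) _).measure_lt_top.ne (fun z => ?_)
      (fun z hz => ?_)
    · rw [abs_mul, abs_mul, abs_abs, abs_of_nonneg (hk0 z)]
      exact mul_le_mul (hgM z) (mul_le_mul (hΩ _) (hkb z) (hk0 z)
        ((norm_nonneg _).trans (hΩ 0))) (mul_nonneg (abs_nonneg _) (hk0 z))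
        ((abs_nonneg _).trans (hgM z))
    · by_contra hne
      refine hz (mem_closedBall_zero_iff.2 (norm_le_of_kernel_ne_zero hρ hθ (min_le_left _ _) ?_
        (right_ne_zero_of_mul (right_ne_zero_of_mul hne))))
      by_contra hlt
      exact hne (by rw [hW0 _ (not_le.1 hlt), zero_mul, mul_zero])
  have hsub : ∀ s t, |s| ≤ M → |t| ≤ M → |s - t| ≤ M + M := fun s t hs ht =>
    (abs_sub _ _).trans (add_le_add hs ht)
  have i1 := hint (fun z => u z.1 - v z.2) (by fun_prop) fun z => hsub _ _ (huM _) (hvM _)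
  have i2 := hint (fun z => v z.1 - v z.2) (by fun_prop) fun z => hsub _ _ (hvM _) (hvM _)
  have i3 := hint (fun z => u z.1 - v z.1) (by fun_prop) fun z => hsub _ _ (huM _) (hvM _)
  have htri : ∫ z, |u z.1 - v z.1| * (W z.1 * kernel ρ θ z) ∂(μ.prod μ) ≤ 6 * κ := by
    calc _ ≤ ∫ z, (|u z.1 - v z.2| * (W z.1 * kernel ρ θ z) +
            |v z.1 - v z.2| * (W z.1 * kernel ρ θ z)) ∂(μ.prod μ) := by
          refine integral_mono_ae i3 (i1.add i2) ?_
          have hae : ∀ᵐ z ∂(μ.prod μ), z.1 ∈ halfPlane :=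
            Measure.quasiMeasurePreserving_fst.ae (ae_restrict_mem measurableSet_halfPlane)
          filter_upwards [hae] with z hz
          rw [← add_mul]
          refine mul_le_mul_of_nonneg_right ?_
            (mul_nonneg (neg_nonneg.2 (hψH _ hz)) (hk0 z))
          rw [abs_sub_comm (v z.1)]
          exact abs_sub_le _ _ _
      _ ≤ 6 * κ := by
          rw [integral_add i1 i2]
          have : 2 * Rψ * (4 * B * P * D * ε * τ) = X * τ := by rw [hX]; ring
          linarith
  have hfub : ∫ z, |u z.1 - v z.1| * (W z.1 * kernel ρ θ z) ∂(μ.prod μ) =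
      ∫ p, |u p - v p| * W p ∂μ := by
    rw [integral_prod _ i3]
    refine setIntegral_congr_fun measurableSet_halfPlane fun p hp => ?_
    have : ∀ q, |u p - v p| * (W p * kernel ρ θ (p, q)) =
        |u p - v p| * W p * kernel ρ θ (p, q) := fun q => by ring
    simp only [this, integral_const_mul]
    rw [hμ, integral_kernel hρ hθ hp, mul_one]
  rw [hfub] at htri
  have hgi : Integrable (fun p => |u p - v p| * W p) := by
    refine integrable_of_bound_of_support (B := (M + M) * Ω) (s := closedBall 0 Rψ)
      (by fun_prop) (isCompact_closedBall (0 : ℝ × ℝ) _).measure_lt_top.ne (fun p => ?_)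
      (fun p hp => by rw [hW0 p (by simpa using hp), mul_zero])
    rw [abs_mul, abs_abs]
    exact mul_le_mul (hsub _ _ (huM _) (hvM _)) (hΩ p) (abs_nonneg _)
      ((abs_nonneg _).trans (hsub _ _ (huM p) (hvM p)))
  have hKm : MeasurableSet (halfPlane ∩ closedBall (0 : ℝ × ℝ) R₀) :=
    measurableSet_halfPlane.inter measurableSet_closedBall
  have hKi : IntegrableOn (fun p => |u p - v p|) (halfPlane ∩ closedBall (0 : ℝ × ℝ) R₀) :=
    (Measure.integrableOn_of_bounded (M := M + M) measure_closedBall_lt_top.ne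
      (by fun_prop : Measurable fun p => |u p - v p|).aestronglyMeasurable
      (ae_of_all _ fun p => by
        rw [Real.norm_eq_abs, abs_abs]
        exact hsub _ _ (huM _) (hvM _))).mono_set inter_subset_right
  have hfin : c * ∫ p in halfPlane ∩ closedBall 0 R₀, |u p - v p| ≤ 6 * κ := by
    rw [← integral_const_mul]
    calc _ ≤ ∫ p in halfPlane ∩ closedBall 0 R₀, |u p - v p| * W p := by
          refine setIntegral_mono_on (hKi.const_mul c) hgi.integrableOn hKm fun p hp => ?_
          have : c ≤ W p := le_neg.2 (hψc p (closedBall_subset_closedBall (le_max_left _ _) hp.2)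
            hp.1)
          rw [mul_comm]
          exact mul_le_mul_of_nonneg_left this (abs_nonneg _)
      _ ≤ ∫ p in halfPlane, |u p - v p| * W p := by
          refine setIntegral_mono_set hgi.integrableOn ?_ inter_subset_left.eventuallyLE
          filter_upwards [ae_restrict_mem measurableSet_halfPlane] with p hp
          exact mul_nonneg (abs_nonneg _) (neg_nonneg.2 (hψH p hp))
      _ ≤ 6 * κ := htri
  have : 6 * κ = c * η := by rw [hκ]; ring
  rw [this] at hfin
  exact le_of_mul_le_mul_left hfin hc

/-! ### Consistency of upwind differences with the weak form -/

theorem TestBound.bound_nonneg {R C : ℝ} {φ : ℝ × ℝ → ℝ} (h : TestBound R C φ) : 0 ≤ C :=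
  (h.nonneg 0).trans (h.le 0)

theorem TestBound.dT_eq_zero {R C : ℝ} {φ : ℝ × ℝ → ℝ} (h : TestBound R C φ) {p : ℝ × ℝ}
    (hp : R < ‖p‖) : dT φ p = 0 := by
  have : φ =ᶠ[𝓝 p] fun _ => 0 :=
    (continuous_norm.continuousAt.eventually (lt_mem_nhds hp)).mono fun q hq => h.supp q hq
  simp [dT, this.fderiv_eq]

theorem TestBound.dX_eq_zero {R C : ℝ} {φ : ℝ × ℝ → ℝ} (h : TestBound R C φ) {p : ℝ × ℝ}
    (hp : R < ‖p‖) : dX φ p = 0 := by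
  have : φ =ᶠ[𝓝 p] fun _ => 0 :=
    (continuous_norm.continuousAt.eventually (lt_mem_nhds hp)).mono fun q hq => h.supp q hq
  simp [dX, this.fderiv_eq]

/-- The quotient is a value of `dT φ` at a point within distance `k`, by the mean value theorem; the
Lipschitz bound on the derivative does the rest, uniformly over the class. -/
theorem TestBound.abs_backward_difference_sub_le {R C k : ℝ} {φ : ℝ × ℝ → ℝ}
    (h : TestBound R C φ) (hk : 0 < k) (p : ℝ × ℝ) :
    |(φ p - φ (p - (0, k))) / k - dT φ p| ≤ C * k := by
  obtain ⟨x, t⟩ := p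
  have hd := hasDerivAt_slice_snd h.test.differentiable x
  obtain ⟨c, hc, hc'⟩ := exists_hasDerivAt_eq_slope (fun s => φ (x, s)) (fun s => dT φ (x, s))
    (show t - k < t by linarith) (fun s _ => (hd s).continuousAt.continuousWithinAt)
    (fun s _ => hd s)
  have e : (φ (x, t) - φ ((x, t) - (0, k))) / k = dT φ (x, c) := by
    rw [hc']
    simp
  rw [e]
  refine (h.lipT _ _).trans (mul_le_mul_of_nonneg_left ?_ h.bound_nonneg)
  simp only [Prod.mk_sub_mk, sub_self, Prod.norm_def, norm_zero, Real.norm_eq_abs]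
  exact max_le hk.le (abs_le.2 ⟨by linarith [hc.1], by linarith [hc.2]⟩)

theorem TestBound.abs_forward_difference_sub_le {R C k : ℝ} {φ : ℝ × ℝ → ℝ}
    (h : TestBound R C φ) (hk : 0 < k) (p : ℝ × ℝ) :
    |(φ (p + (k, 0)) - φ p) / k - dX φ p| ≤ C * k := by
  obtain ⟨x, t⟩ := p
  have hd := fun y => hasDerivAt_slice_fst h.test.differentiable y t
  obtain ⟨c, hc, hc'⟩ := exists_hasDerivAt_eq_slope (fun s => φ (s, t)) (fun s => dX φ (s, t))
    (show x < x + k by linarith) (fun s _ => (hd s).continuousAt.continuousWithinAt)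
    (fun s _ => hd s)
  have e : (φ ((x, t) + (k, 0)) - φ (x, t)) / k = dX φ (c, t) := by
    rw [hc']
    simp
  rw [e]
  refine (h.lipX _ _).trans (mul_le_mul_of_nonneg_left ?_ h.bound_nonneg)
  simp only [Prod.mk_sub_mk, sub_self, Prod.norm_def, norm_zero, Real.norm_eq_abs]
  exact max_le (abs_le.2 ⟨by linarith [hc.1], by linarith [hc.2]⟩) hk.le

/-- A finite difference inequality of upwind type holds in the sense of distributions up to an
error of the order of the mesh size. -/
theorem upwind_consistency {A Q : ℝ × ℝ → ℝ} (hA : Measurable A) (hQ : Measurable Q) {B : ℝ}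
    (hAB : ∀ p, |A p| ≤ B) (hQB : ∀ p, |Q p| ≤ B) {α : ℝ → ℝ} (hα : Measurable α)
    (hαB : ∀ x, |α x| ≤ B) {h k : ℝ} (hh : 0 < h)
    (hh1 : h ≤ 1) (hk : 0 < k) (hk1 : k ≤ 1)
    (hstep : ∀ p : ℝ × ℝ, 0 < p.2 → A (p + (0, k)) - A p + k / h * (Q p - Q (p - (h, 0))) ≤ 0)
    (hinit : ∀ p : ℝ × ℝ, p.2 < k → A p = α p.1) {R C : ℝ} {φ : ℝ × ℝ → ℝ} (hR : 0 ≤ R)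
    (hφ : TestBound R C φ) :
    -(B * C * (h + k) * (volume.real (closedBall (0 : ℝ × ℝ) (R + 1)) + 2 * R)) ≤
      (∫ p in halfPlane, (A p * dT φ p + Q p * dX φ p)) + ∫ x, α x * φ (x, 0) := by
  have hB0 : 0 ≤ B := (abs_nonneg _).trans (hAB 0)
  have hC0 := hφ.bound_nonneg
  have hφm := hφ.test.1.continuous.measurable
  have hφT := hφ.test.continuous_dT.measurable
  have hφX := hφ.test.continuous_dX.measurable
  have hint : ∀ g χ : ℝ × ℝ → ℝ, Measurable g → (∀ p, |g p| ≤ B) → Integrable χ →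
      Integrable fun p => g p * χ p := fun g χ hg hgB hχ =>
    hχ.bdd_mul hg.aestronglyMeasurable (ae_of_all _ hgB)
  have hi0 := hφ.test.integrable
  have hiT : Integrable fun p => φ (p - (0, k)) := hi0.comp_sub_right _
  have hiX : Integrable fun p => φ (p + (h, 0)) := hi0.comp_add_right _
  -- Translation in time by `k` leaves out this layer, which supplies the initial term.
  set S : Set (ℝ × ℝ) := univ ×ˢ Ioc 0 k with hS
  have hSm : MeasurableSet S := MeasurableSet.univ.prod measurableSet_Ioc
  have t1 : ∫ p in halfPlane, A (p + (0, k)) * φ p =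
      (∫ p in halfPlane, A p * φ (p - (0, k))) - ∫ p in S, A p * φ (p - (0, k)) := by
    have hsub : S ⊆ halfPlane := fun p hp => hp.2.1
    rw [← setIntegral_sdiff hSm (hint _ _ hA hAB hiT).integrableOn hsub,
      ← integral_indicator measurableSet_halfPlane,
      ← integral_indicator (measurableSet_halfPlane.diff hSm),
      ← integral_sub_right_eq_self _ ((0, k) : ℝ × ℝ)]
    refine integral_congr_ae (ae_of_all _ fun p => ?_)
    have hiff : p - (0, k) ∈ halfPlane ↔ p ∈ halfPlane \ S := by
      simp only [halfPlane, hS, Set.mem_ofPred_eq, Set.mem_sdiff, Prod.snd_sub, mem_prod, mem_univ,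
        true_and, mem_Ioc, not_and, not_le, sub_pos]
      exact ⟨fun h => ⟨hk.trans h, fun _ => h⟩, fun h => h.2 h.1⟩
    by_cases hp : p - (0, k) ∈ halfPlane
    · simp only [indicator_of_mem hp, indicator_of_mem (hiff.1 hp), sub_add_cancel]
    · simp only [indicator_of_notMem hp, indicator_of_notMem (mt hiff.2 hp)]
  have t2 : ∫ p in halfPlane, Q (p - (h, 0)) * φ p =
      ∫ p in halfPlane, Q p * φ (p + (h, 0)) := by
    rw [← integral_indicator measurableSet_halfPlane,
      ← integral_indicator measurableSet_halfPlane,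
      ← integral_add_right_eq_self _ ((h, 0) : ℝ × ℝ)]
    refine integral_congr_ae (ae_of_all _ fun p => ?_)
    by_cases hp : p ∈ halfPlane
    · have hp' : p + (h, 0) ∈ halfPlane := by simpa [halfPlane] using hp
      simp only [indicator_of_mem hp, indicator_of_mem hp', add_sub_cancel_right]
    · have hp' : p + (h, 0) ∉ halfPlane := by simpa [halfPlane] using hp
      simp only [indicator_of_notMem hp, indicator_of_notMem hp']
  have j1 : IntegrableOn (fun p => A (p + (0, k)) * φ p) halfPlane :=
    (hint _ _ (by fun_prop) (fun p => hAB _) hi0).integrableOn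
  have j2 : IntegrableOn (fun p => A p * φ p) halfPlane := (hint _ _ hA hAB hi0).integrableOn
  have j3 : IntegrableOn (fun p => Q p * φ p) halfPlane := (hint _ _ hQ hQB hi0).integrableOn
  have j4 : IntegrableOn (fun p => Q (p - (h, 0)) * φ p) halfPlane :=
    (hint _ _ (by fun_prop) (fun p => hQB _) hi0).integrableOn
  have j5 : IntegrableOn (fun p => A p * φ (p - (0, k))) halfPlane :=
    (hint _ _ hA hAB hiT).integrableOn
  have j6 : IntegrableOn (fun p => Q p * φ (p + (h, 0))) halfPlane :=
    (hint _ _ hQ hQB hiX).integrableOn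
  have j7 : IntegrableOn (fun p => A p * dT φ p) halfPlane :=
    (hint _ _ hA hAB hφ.test.integrable_dT).integrableOn
  have j8 : IntegrableOn (fun p => Q p * dX φ p) halfPlane :=
    (hint _ _ hQ hQB hφ.test.integrable_dX).integrableOn
  have j12 : IntegrableOn (fun p => A (p + (0, k)) * φ p - A p * φ p) halfPlane := j1.sub j2
  have j34 : IntegrableOn (fun p => Q p * φ p - Q (p - (h, 0)) * φ p) halfPlane := j3.sub j4
  have j25 : IntegrableOn (fun p => A p * φ p / k - A p * φ (p - (0, k)) / k) halfPlane :=
    (j2.div_const k).sub (j5.div_const k)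
  have j63 : IntegrableOn (fun p => Q p * φ (p + (h, 0)) / h - Q p * φ p / h) halfPlane :=
    (j6.div_const h).sub (j3.div_const h)
  have j78 : IntegrableOn (fun p => A p * dT φ p + Q p * dX φ p) halfPlane := j7.add j8
  -- The step inequality is multiplied by `φ ≥ 0` and integrated; the translations `t1` and `t2`
  -- then move the differences to `φ`, a summation by parts without sums.
  have hneg : (∫ p in halfPlane, A (p + (0, k)) * φ p) - (∫ p in halfPlane, A p * φ p) +
      k / h * ((∫ p in halfPlane, Q p * φ p) - ∫ p in halfPlane, Q (p - (h, 0)) * φ p) ≤ 0 := by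
    rw [← integral_sub j1 j2, ← integral_sub j3 j4, ← integral_const_mul,
      ← integral_add j12 (j34.const_mul _)]
    refine setIntegral_nonpos measurableSet_halfPlane fun p hp => ?_
    have := mul_nonpos_of_nonpos_of_nonneg (hstep p hp) (hφ.nonneg p)
    linarith
  rw [t1, t2] at hneg
  -- Shifts by `h, k ≤ 1` stay in the ball of radius `R + 1`.
  have hsup : ∀ p : ℝ × ℝ, p ∉ closedBall (0 : ℝ × ℝ) (R + 1) → ∀ w : ℝ × ℝ, ‖w‖ ≤ 1 →
      R < ‖p + w‖ := fun p hp w hw => by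
    rw [mem_closedBall_zero_iff, not_le] at hp
    have := norm_sub_norm_le p (-w)
    rw [sub_neg_eq_add, norm_neg] at this
    linarith
  have hdiff : (∫ p in halfPlane, A p * φ p) / k - (∫ p in halfPlane, A p * φ (p - (0, k))) / k +
      ((∫ p in halfPlane, Q p * φ (p + (h, 0))) / h - (∫ p in halfPlane, Q p * φ p) / h) ≤
      (∫ p in halfPlane, (A p * dT φ p + Q p * dX φ p)) +
        B * C * (h + k) * volume.real (closedBall (0 : ℝ × ℝ) (R + 1)) := by
    have hci : Integrable (indicator (closedBall (0 : ℝ × ℝ) (R + 1))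
        fun _ => B * C * (h + k)) :=
      (integrable_indicator_iff measurableSet_closedBall).2
        (integrableOn_const measure_closedBall_lt_top.ne)
    have hc : B * C * (h + k) * volume.real (closedBall (0 : ℝ × ℝ) (R + 1)) =
        ∫ p, indicator (closedBall (0 : ℝ × ℝ) (R + 1)) (fun _ => B * C * (h + k)) p := by
      rw [integral_indicator measurableSet_closedBall, setIntegral_const, smul_eq_mul, mul_comm]
    have hle : ∫ p in halfPlane, indicator (closedBall (0 : ℝ × ℝ) (R + 1))
        (fun _ => B * C * (h + k)) p ≤
        ∫ p, indicator (closedBall (0 : ℝ × ℝ) (R + 1)) (fun _ => B * C * (h + k)) p :=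
      setIntegral_le_integral hci (ae_of_all _ fun p => indicator_nonneg
        (fun _ _ => by positivity) p)
    rw [hc]
    refine le_trans ?_ (add_le_add le_rfl hle)
    simp only [← integral_div]
    rw [← integral_sub (j2.div_const k) (j5.div_const k),
      ← integral_sub (j6.div_const h) (j3.div_const h),
      ← integral_add j25 j63, ← integral_add j78 hci.integrableOn]
    refine integral_mono (j25.add j63) (j78.add hci.integrableOn) fun p => ?_
    have hsplit : A p * φ p / k - A p * φ (p - (0, k)) / k +
        (Q p * φ (p + (h, 0)) / h - Q p * φ p / h) = (A p * dT φ p + Q p * dX φ p) +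
        (A p * ((φ p - φ (p - (0, k))) / k - dT φ p) +
          Q p * ((φ (p + (h, 0)) - φ p) / h - dX φ p)) := by ring
    rw [hsplit]
    refine add_le_add le_rfl ?_
    by_cases hp : p ∈ closedBall (0 : ℝ × ℝ) (R + 1)
    · rw [indicator_of_mem hp]
      have b1 : A p * ((φ p - φ (p - (0, k))) / k - dT φ p) ≤ B * (C * k) :=
        (le_abs_self _).trans ((abs_mul _ _).trans_le (mul_le_mul (hAB p)
          (hφ.abs_backward_difference_sub_le hk p) (abs_nonneg _) hB0))
      have b2 : Q p * ((φ (p + (h, 0)) - φ p) / h - dX φ p) ≤ B * (C * h) :=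
        (le_abs_self _).trans ((abs_mul _ _).trans_le (mul_le_mul (hQB p)
          (hφ.abs_forward_difference_sub_le hh p) (abs_nonneg _) hB0))
      linarith
    · rw [indicator_of_notMem hp]
      have z1 : φ p = 0 := hφ.supp _ (by simpa using hsup p hp 0 (by simp))
      have z2 : φ (p - (0, k)) = 0 := hφ.supp _ (by
        rw [sub_eq_add_neg]
        exact hsup p hp _ (by simp [Prod.norm_def, abs_of_pos hk, hk1]))
      have z3 : φ (p + (h, 0)) = 0 :=
        hφ.supp _ (hsup p hp _ (by simp [Prod.norm_def, abs_of_pos hh, hh1]))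
      have z4 : dT φ p = 0 := hφ.dT_eq_zero (by simpa using hsup p hp 0 (by simp))
      have z5 : dX φ p = 0 := hφ.dX_eq_zero (by simpa using hsup p hp 0 (by simp))
      simp [z1, z2, z3, z4, z5]
  have hlayer : (∫ p in S, A p * φ (p - (0, k))) / k ≤
      (∫ x, α x * φ (x, 0)) + B * C * k * (2 * R) := by
    set g : ℝ → ℝ := fun x => α x * φ (x, 0) +
      indicator (Icc (-R) R) (fun _ => B * C * k) x with hg
    have gi1 : Integrable fun x => α x * φ (x, 0) :=
      (hφ.test.integrable_slice 0).bdd_mul hα.aestronglyMeasurable (ae_of_all _ hαB)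
    have gi2 : Integrable (indicator (Icc (-R) R) fun _ : ℝ => B * C * k) :=
      (integrable_indicator_iff measurableSet_Icc).2
        (integrableOn_const isCompact_Icc.measure_lt_top.ne)
    have hgi : IntegrableOn (fun p : ℝ × ℝ => g p.1 * 1) S := by
      rw [hS, Measure.volume_eq_prod, IntegrableOn, ← Measure.prod_restrict, Measure.restrict_univ]
      exact (gi1.add gi2).mul_prod (integrableOn_const (s := Ioc 0 k) (by simp))
    have hgint : ∫ p in S, g p.1 * 1 = (∫ x, g x) * k := by
      rw [hS, Measure.volume_eq_prod, setIntegral_prod_mul g fun _ => (1 : ℝ)]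
      simp [hk.le]
    have hg2 : ∫ x, g x = (∫ x, α x * φ (x, 0)) + B * C * k * (2 * R) := by
      rw [hg, integral_add gi1 gi2, integral_indicator measurableSet_Icc, setIntegral_const,
        Real.volume_real_Icc_of_le (by linarith), smul_eq_mul]
      ring
    rw [div_le_iff₀ hk, ← hg2, ← hgint]
    refine setIntegral_mono_on_ae (hint _ _ hA hAB hiT).integrableOn hgi hSm ?_
    -- `A` is known to be initial only for `t < k`, while the layer contains the null line `t = k`.
    have hne : ∀ᵐ p : ℝ × ℝ, p.2 ≠ k := by
      have : ∀ᵐ s : ℝ, s ≠ k := by simp [ae_iff]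
      rw [Measure.volume_eq_prod]
      exact Measure.quasiMeasurePreserving_snd.ae this
    filter_upwards [hne] with p hpk hpS
    have hlt : p.2 < k := lt_of_le_of_ne hpS.2.2 hpk
    rw [hinit p hlt, mul_one, hg]
    obtain ⟨x, t⟩ := p
    simp only [Prod.mk_sub_mk, sub_zero]
    by_cases hx : x ∈ Icc (-R) R
    · rw [indicator_of_mem hx]
      have hl : |φ (x, t - k) - φ (x, 0)| ≤ C * k := by
        refine (hφ.lip _ _).trans (mul_le_mul_of_nonneg_left ?_ hC0)
        simp only [Prod.mk_sub_mk, sub_self, sub_zero, Prod.norm_def, norm_zero,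
          Real.norm_eq_abs]
        exact max_le hk.le (abs_le.2 ⟨by linarith [hpS.2.1], by linarith⟩)
      have := (le_abs_self _).trans ((abs_mul _ _).trans_le (mul_le_mul (hαB x) hl
        (abs_nonneg _) hB0))
      linarith
    · have hz : ∀ s, φ (x, s) = 0 := fun s => hφ.supp _ (lt_of_not_ge fun hle =>
        hx (abs_le.1 ((le_max_left _ _).trans hle)))
      simp [indicator_of_notMem hx, hz]
  have hfinal : 0 ≤ (∫ p in halfPlane, A p * φ p) / k -
      (∫ p in halfPlane, A p * φ (p - (0, k))) / k +
      ((∫ p in halfPlane, Q p * φ (p + (h, 0))) / h - (∫ p in halfPlane, Q p * φ p) / h) +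
      (∫ p in S, A p * φ (p - (0, k))) / k := by
    have := div_nonneg (neg_nonneg.2 hneg) hk.le
    refine this.trans_eq ?_
    field_simp
    ring
  have hrest : B * C * k * (2 * R) ≤ B * C * (h + k) * (2 * R) := by
    gcongr
    linarith
  linarith

/-! ### Monotonicity, maximum principle and entropy inequalities of one step -/

theorem monotoneOn_id_sub_mul {f : ℝ → ℝ} (hf : Differentiable ℝ f) {m m' r : ℝ}
    (hcfl : ∀ v ∈ Icc m m', r * |deriv f v| ≤ 1) (hr : 0 ≤ r) :
    MonotoneOn (fun v => v - r * f v) (Icc m m') := by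
  have hd : ∀ v, HasDerivAt (fun v => v - r * f v) (1 - r * deriv f v) v := fun v =>
    (hasDerivAt_id v).sub ((hf v).hasDerivAt.const_mul r)
  refine monotoneOn_of_deriv_nonneg (convex_Icc m m')
    (fun v _ => (hd v).continuousAt.continuousWithinAt)
    (fun v _ => (hd v).differentiableAt.differentiableWithinAt) fun v hv => ?_
  rw [(hd v).deriv, sub_nonneg]
  exact (mul_le_mul_of_nonneg_left (le_abs_self _) hr).trans (hcfl v (interior_subset hv))

/-- The discrete maximum principle. -/
theorem upwind_value_mem_Icc {f : ℝ → ℝ} (hf : Differentiable ℝ f) (hmono : Monotone f)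
    {m m' r : ℝ} (hcfl : ∀ v ∈ Icc m m', r * |deriv f v| ≤ 1) (hr : 0 ≤ r) {a b : ℝ}
    (ha : a ∈ Icc m m') (hb : b ∈ Icc m m') : b - r * (f b - f a) ∈ Icc m m' := by
  have hG := monotoneOn_id_sub_mul hf hcfl hr
  have hm : m ∈ Icc m m' := ⟨le_rfl, hb.1.trans hb.2⟩
  have hm' : m' ∈ Icc m m' := ⟨hb.1.trans hb.2, le_rfl⟩
  have h1 := hG hm hb hb.1
  have h2 := hG hb hm' hb.2
  have h3 := mul_le_mul_of_nonneg_left (hmono ha.1) hr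
  have h4 := mul_le_mul_of_nonneg_left (hmono ha.2) hr
  simp only at h1 h2
  constructor <;> linarith

/-- The entropy inequality of the upwind scheme for a pair `(U, F)` on the interval `[m, m']`. -/
def DiscreteEntropy (f U F : ℝ → ℝ) (m m' r : ℝ) : Prop :=
  ∀ a ∈ Icc m m', ∀ b ∈ Icc m m', U (b - r * (f b - f a)) - U b + r * (F b - F a) ≤ 0

/-- Fix `a` and let `b = v` vary. The function `G` has derivative `(1 - r f'(v)) (U'(v) - U'(v - r
(f v - f a)))`. Its first factor is nonnegative by CFL, and its second has the sign of `v - a`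
because `f` is nondecreasing and `U'` is monotone. Hence `G a ≤ G b`, which is the claim. Strict
convexity is not required, so that `U = id` and `U = -id` are allowed later. -/
theorem discreteEntropy_of_convexOn {f : ℝ → ℝ} (hf : Differentiable ℝ f) (hmono : Monotone f)
    {m m' r : ℝ} (hcfl : ∀ v ∈ Icc m m', r * |deriv f v| ≤ 1) (hr : 0 ≤ r) {U F : ℝ → ℝ}
    (hU : Differentiable ℝ U) (hUc : ConvexOn ℝ univ U)
    (hF : ∀ v, HasDerivAt F (deriv U v * deriv f v) v) : DiscreteEntropy f U F m m' r := by
  intro a ha b hb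
  have hUm : Monotone (deriv U) :=
    monotoneOn_univ.1 (hUc.monotoneOn_deriv fun v _ => hU v)
  set G : ℝ → ℝ := fun v => U v - r * F v - U (v - r * (f v - f a)) with hG
  have hd : ∀ v, HasDerivAt G
      ((1 - r * deriv f v) * (deriv U v - deriv U (v - r * (f v - f a)))) v := by
    intro v
    have h1 : HasDerivAt (fun v => v - r * (f v - f a)) (1 - r * deriv f v) v :=
      (hasDerivAt_id v).sub (((hf v).hasDerivAt.sub_const (f a)).const_mul r)
    have h2 := (((hU v).hasDerivAt.sub ((hF v).const_mul r))).sub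
      ((hU (v - r * (f v - f a))).hasDerivAt.comp v h1)
    refine h2.congr_deriv ?_
    ring
  have hpos : ∀ v ∈ Icc m m', 0 ≤ 1 - r * deriv f v := fun v hv => sub_nonneg.2
    ((mul_le_mul_of_nonneg_left (le_abs_self _) hr).trans (hcfl v hv))
  have hGc : Continuous G := continuous_iff_continuousAt.2 fun v => (hd v).continuousAt
  have hGa : G a ≤ G b := by
    rcases le_total a b with hab | hab
    · refine monotoneOn_of_deriv_nonneg (convex_Icc a b) hGc.continuousOn
        (fun v _ => (hd v).differentiableAt.differentiableWithinAt) (fun v hv => ?_)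
        (left_mem_Icc.2 hab) (right_mem_Icc.2 hab) hab
      have hv' := interior_subset hv
      rw [(hd v).deriv]
      refine mul_nonneg (hpos v ⟨ha.1.trans hv'.1, hv'.2.trans hb.2⟩)
        (sub_nonneg.2 (hUm ?_))
      have := mul_nonneg hr (sub_nonneg.2 (hmono hv'.1))
      linarith
    · refine antitoneOn_of_deriv_nonpos (convex_Icc b a) hGc.continuousOn
        (fun v _ => (hd v).differentiableAt.differentiableWithinAt) (fun v hv => ?_)
        (left_mem_Icc.2 hab) (right_mem_Icc.2 hab) hab
      have hv' := interior_subset hv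
      rw [(hd v).deriv]
      refine mul_nonpos_of_nonneg_of_nonpos (hpos v ⟨hb.1.trans hv'.1, hv'.2.trans ha.2⟩)
        (sub_nonpos.2 (hUm ?_))
      have := mul_nonneg hr (sub_nonneg.2 (hmono hv'.2))
      linarith
  simp only [hG, sub_self, mul_zero, sub_zero] at hGa
  linarith

/-- For `κ` in the range, the new value minus `κ` is the sum of an increment of `v - r f v` and one
of `r f`; both functions are nondecreasing, so the triangle inequality splits exactly as needed. For
`κ` outside the range all signs are fixed and the inequality is an equality expressing conservation,
which is why no CFL bound at `κ` is needed. -/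
theorem discreteEntropy_kruzkov {f : ℝ → ℝ} (hf : Differentiable ℝ f) (hmono : Monotone f)
    {m m' r : ℝ} (hcfl : ∀ v ∈ Icc m m', r * |deriv f v| ≤ 1) (hr : 0 ≤ r) (κ : ℝ) :
    DiscreteEntropy f (fun v => |v - κ|) (fun v => |f v - f κ|) m m' r := by
  intro a ha b hb
  have hc := upwind_value_mem_Icc hf hmono hcfl hr ha hb
  have hG := monotoneOn_id_sub_mul hf hcfl hr
  simp only
  set c := b - r * (f b - f a) with hcdef
  rcases lt_or_ge κ m with hκ | hκ
  · rw [abs_of_nonneg (by linarith [hc.1]), abs_of_nonneg (by linarith [hb.1]),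
      abs_of_nonneg (sub_nonneg.2 (hmono (hκ.le.trans hb.1))),
      abs_of_nonneg (sub_nonneg.2 (hmono (hκ.le.trans ha.1))), hcdef]
    linarith
  rcases lt_or_ge m' κ with hκ' | hκ'
  · rw [abs_of_nonpos (by linarith [hc.2]), abs_of_nonpos (by linarith [hb.2]),
      abs_of_nonpos (sub_nonpos.2 (hmono (hb.2.trans hκ'.le))),
      abs_of_nonpos (sub_nonpos.2 (hmono (ha.2.trans hκ'.le))), hcdef]
    linarith
  have h1 : |c - κ| ≤ |(b - r * f b) - (κ - r * f κ)| + r * |f a - f κ| := by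
    have : c - κ = ((b - r * f b) - (κ - r * f κ)) + r * (f a - f κ) := by
      rw [hcdef]
      ring
    rw [this]
    refine (abs_add_le _ _).trans_eq ?_
    rw [abs_mul r, abs_of_nonneg hr]
  have h2 : |(b - r * f b) - (κ - r * f κ)| = |b - κ| - r * |f b - f κ| := by
    rcases le_total b κ with h | h
    · have := hG hb ⟨hκ, hκ'⟩ h
      simp only at this
      rw [abs_of_nonpos (by linarith), abs_of_nonpos (by linarith),
        abs_of_nonpos (sub_nonpos.2 (hmono h))]
      ring
    · have := hG ⟨hκ, hκ'⟩ hb h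
      simp only at this
      rw [abs_of_nonneg (by linarith), abs_of_nonneg (by linarith),
        abs_of_nonneg (sub_nonneg.2 (hmono h))]
      ring
  rw [h2] at h1
  linarith

/-! ### The scheme as a function on the half-plane -/

theorem cellAverage_mem_Icc {a : ℝ → ℝ} {m m' : ℝ} (ha : Measurable a)
    (ham : ∀ x, a x ∈ Icc m m') {Δx : ℝ} (hΔx : 0 < Δx) (j : ℤ) :
    cellAverage Δx a j ∈ Icc m m' := by
  have hlen : interface Δx j - interface Δx (j - 1) = Δx := by
    simp only [interface]
    push_cast
    ring
  have hle : interface Δx (j - 1) ≤ interface Δx j := by linarith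
  have hi : IntervalIntegrable a volume (interface Δx (j - 1)) (interface Δx j) := by
    rw [intervalIntegrable_iff_integrableOn_Ioc_of_le hle]
    refine Measure.integrableOn_of_bounded (M := max |m| |m'|) (by simp)
      ha.aestronglyMeasurable (ae_of_all _ fun x => ?_)
    exact abs_le_max_abs_abs (ham x).1 (ham x).2
  have h1 := intervalIntegral.integral_mono_on hle intervalIntegrable_const hi
    fun x _ => (ham x).1
  have h2 := intervalIntegral.integral_mono_on hle hi intervalIntegrable_const
    fun x _ => (ham x).2
  rw [intervalIntegral.integral_const, hlen, smul_eq_mul] at h1 h2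
  rw [cellAverage, one_div_mul_eq_div]
  exact ⟨(le_div_iff₀ hΔx).2 (by linarith), (div_le_iff₀ hΔx).2 (by linarith)⟩

theorem upwind_mem_Icc {f a : ℝ → ℝ} (hf : Differentiable ℝ f) (hmono : Monotone f)
    {m m' : ℝ} (ha : Measurable a) (ham : ∀ x, a x ∈ Icc m m') {Δx Δt : ℝ} (hΔx : 0 < Δx)
    (hΔt : 0 < Δt) (hcfl : ∀ v ∈ Icc m m', Δt / Δx * |deriv f v| ≤ 1) (n : ℕ) :
    ∀ j, upwind f a Δx Δt n j ∈ Icc m m' := by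
  induction n with
  | zero => exact cellAverage_mem_Icc ha ham hΔx
  | succ n ih =>
    exact fun j => upwind_value_mem_Icc hf hmono hcfl (by positivity) (ih (j - 1)) (ih j)

theorem measurable_upwindApprox (f a : ℝ → ℝ) (Δx Δt : ℝ) :
    Measurable (upwindApprox f a Δx Δt) := by
  have h : Measurable fun z : ℕ × ℤ => upwind f a Δx Δt z.1 (z.2 + 1) := measurable_of_countable _
  exact h.comp (f := fun p : ℝ × ℝ => (⌊p.2 / Δt⌋₊, ⌊p.1 / Δx⌋))
    ((Nat.measurable_floor.comp (by fun_prop)).prodMk (Int.measurable_floor.comp (by fun_prop)))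

/-- Shifting by one mesh size changes the relevant floor by exactly one, so the recursion holds at
every point and not only on the grid. This lets consistency be proved with integrals. -/
theorem upwindApprox_add {f a : ℝ → ℝ} {Δx Δt : ℝ} (hΔx : 0 < Δx) (hΔt : 0 < Δt)
    {p : ℝ × ℝ} (hp : 0 ≤ p.2) :
    upwindApprox f a Δx Δt (p + (0, Δt)) = upwindApprox f a Δx Δt p -
      Δt / Δx * (f (upwindApprox f a Δx Δt p) - f (upwindApprox f a Δx Δt (p - (Δx, 0)))) := by
  have h1 : ⌊(p.2 + Δt) / Δt⌋₊ = ⌊p.2 / Δt⌋₊ + 1 := by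
    rw [add_div, div_self hΔt.ne', Nat.floor_add_one (by positivity)]
  have h2 : ⌊(p.1 - Δx) / Δx⌋ = ⌊p.1 / Δx⌋ - 1 := by
    rw [sub_div, div_self hΔx.ne', Int.floor_sub_one]
  simp only [upwindApprox, Prod.snd_add, Prod.fst_add, Prod.fst_sub, Prod.snd_sub, add_zero,
    sub_zero, h1, h2]
  rw [upwind, conservativeStep]
  simp only [add_sub_cancel_right, sub_add_cancel]

theorem upwindApprox_of_lt {f a : ℝ → ℝ} {Δx Δt : ℝ} (hΔt : 0 < Δt) {p : ℝ × ℝ}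
    (hp : p.2 < Δt) : upwindApprox f a Δx Δt p = upwindApprox f a Δx Δt (p.1, 0) := by
  have h1 : ⌊p.2 / Δt⌋₊ = 0 := Nat.floor_eq_zero.2 ((div_lt_one hΔt).2 hp)
  simp [upwindApprox, h1]

/-- The initial values of the scheme converge almost everywhere. -/
theorem ae_tendsto_upwindApprox_zero (f : ℝ → ℝ) {a : ℝ → ℝ} {M : ℝ} (ha : Measurable a)
    (haM : ∀ x, |a x| ≤ M) {Δx Δt : ℕ → ℝ} (hΔx : ∀ k, 0 < Δx k)
    (hΔx0 : Tendsto Δx atTop (𝓝 0)) :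
    ∀ᵐ x, Tendsto (fun k => upwindApprox f a (Δx k) (Δt k) (x, 0)) atTop (𝓝 (a x)) := by
  have hloc : LocallyIntegrable a := fun x =>
    ⟨closedBall x 1, closedBall_mem_nhds x one_pos,
      Measure.integrableOn_of_bounded (M := M) measure_closedBall_lt_top.ne
        ha.aestronglyMeasurable (ae_of_all _ haM)⟩
  have hlim : Tendsto (fun k => Δx k / 2) atTop (𝓝[>] 0) :=
    tendsto_nhdsWithin_iff.2 ⟨by simpa using hΔx0.div_const 2,
      Eventually.of_forall fun k => half_pos (hΔx k)⟩
  filter_upwards [IsUnifLocDoublingMeasure.ae_tendsto_average volume hloc 1] with x hx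
  -- The cell of `x` is, up to an endpoint, the closed ball of radius `Δx / 2` about its midpoint.
  -- It is not centred at `x`, hence differentiation with moving centres.
  refine (hx (fun k => (⌊x / Δx k⌋ + 1 / 2) * Δx k) _ hlim (Eventually.of_forall fun k => ?_)).congr
    fun k => ?_
  · have h1 := mul_le_mul_of_nonneg_right (Int.floor_le (x / Δx k)) (hΔx k).le
    have h2 := mul_lt_mul_of_pos_right (Int.lt_floor_add_one (x / Δx k)) (hΔx k)
    rw [div_mul_cancel₀ _ (hΔx k).ne'] at h1 h2
    rw [mem_closedBall, Real.dist_eq, abs_le]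
    constructor <;> linarith
  · have hk := hΔx k
    have e1 : (⌊x / Δx k⌋ + 1 / 2) * Δx k - Δx k / 2 = interface (Δx k) ⌊x / Δx k⌋ := by
      simp only [interface]
      ring
    have e2 : (⌊x / Δx k⌋ + 1 / 2) * Δx k + Δx k / 2 = interface (Δx k) (⌊x / Δx k⌋ + 1) := by
      simp only [interface]
      push_cast
      ring
    simp only [upwindApprox, zero_div, Nat.floor_zero, upwind, cellAverage, add_sub_cancel_right]
    rw [setAverage_eq, Real.volume_real_closedBall (half_pos hk).le, smul_eq_mul,
      Real.closedBall_eq_Icc, e1, e2, integral_Icc_eq_integral_Ioc,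
      ← intervalIntegral.integral_of_le (by linarith)]
    congr 1
    field_simp

/-- The scheme satisfies the entropy inequalities up to an error of the order of the mesh size. -/
theorem upwindApprox_weakForm {f a : ℝ → ℝ} (hf : Differentiable ℝ f) (hmono : Monotone f)
    {m m' : ℝ} (ha : Measurable a) (ham : ∀ x, a x ∈ Icc m m') {Δx Δt : ℝ} (hΔx : 0 < Δx)
    (hΔt : 0 < Δt) (hcfl : ∀ v ∈ Icc m m', Δt / Δx * |deriv f v| ≤ 1) (hΔx1 : Δx ≤ 1)
    (hΔt1 : Δt ≤ 1) {U F : ℝ → ℝ} (hU : Measurable U) (hF : Measurable F)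
    (hUF : DiscreteEntropy f U F m m' (Δt / Δx)) {B : ℝ} (hUB : ∀ v ∈ Icc m m', |U v| ≤ B)
    (hFB : ∀ v ∈ Icc m m', |F v| ≤ B) {R C : ℝ} (hR : 0 ≤ R) {φ : ℝ × ℝ → ℝ}
    (hφ : TestBound R C φ) :
    -(B * C * (Δx + Δt) * (volume.real (closedBall (0 : ℝ × ℝ) (R + 1)) + 2 * R)) ≤
      weakForm U F (fun x => upwindApprox f a Δx Δt (x, 0)) (upwindApprox f a Δx Δt) φ := by
  have hmem : ∀ p, upwindApprox f a Δx Δt p ∈ Icc m m' := fun p =>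
    upwind_mem_Icc hf hmono ha ham hΔx hΔt hcfl _ _
  have hm := measurable_upwindApprox f a Δx Δt
  refine upwind_consistency (hU.comp hm) (hF.comp hm) (fun p => hUB _ (hmem p))
    (fun p => hFB _ (hmem p)) (α := fun x => U (upwindApprox f a Δx Δt (x, 0)))
    (by fun_prop) (fun x => hUB _ (hmem _)) hΔx hΔx1 hΔt hΔt1 (fun p hp => ?_)
    (fun p hp => ?_) hR hφ
  · simp only [Function.comp]
    rw [upwindApprox_add hΔx hΔt hp.le]
    exact hUF _ (hmem _) _ (hmem _)
  · simp only [Function.comp]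
    rw [upwindApprox_of_lt hΔt hp]

/-! ### Representatives and limits in the weak form -/

theorem weakForm_congr {U F u₀ u₀' : ℝ → ℝ} {u u' : ℝ × ℝ → ℝ} (h₀ : u₀ =ᵐ[volume] u₀')
    (h : u =ᵐ[volume.restrict halfPlane] u') (φ : ℝ × ℝ → ℝ) :
    weakForm U F u₀ u φ = weakForm U F u₀' u' φ := by
  unfold weakForm
  congr 1
  · refine integral_congr_ae ?_
    filter_upwards [h] with p hp
    rw [hp]
  · refine integral_congr_ae ?_
    filter_upwards [h₀] with x hx
    rw [hx]

/-- Clamping a measurable representative to the interval turns almost everywhere bounds into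
pointwise ones. -/
theorem exists_measurable_mem_Icc {α : Type*} [MeasurableSpace α] {μ : Measure α} {g : α → ℝ}
    (hg : AEMeasurable g μ) {m m' : ℝ} (hm : m ≤ m') (h : ∀ᵐ x ∂μ, g x ∈ Icc m m') :
    ∃ g' : α → ℝ, Measurable g' ∧ (∀ x, g' x ∈ Icc m m') ∧ g =ᵐ[μ] g' := by
  have hmk := hg.measurable_mk
  refine ⟨fun x => max m (min m' (hg.mk g x)), by fun_prop,
    fun x => ⟨le_max_left _ _, max_le hm (min_le_left _ _)⟩, ?_⟩
  filter_upwards [h, hg.ae_eq_mk] with x hx hx'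
  rw [← hx', min_eq_right hx.2, max_eq_right hx.1]

/-- Dominated convergence. The entropies vary when Kruzkov's entropies are approximated; the
functions and data vary when the mesh is refined. -/
theorem weakForm_tendsto {U F b : ℕ → ℝ → ℝ} {w : ℕ → ℝ × ℝ → ℝ} {U' F' b' : ℝ → ℝ}
    {w' : ℝ × ℝ → ℝ} {B : ℝ} (hU : ∀ n, Measurable (U n)) (hF : ∀ n, Measurable (F n))
    (hb : ∀ n, Measurable (b n)) (hw : ∀ n, Measurable (w n))
    (hUB : ∀ n p, |U n (w n p)| ≤ B) (hFB : ∀ n p, |F n (w n p)| ≤ B)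
    (hbB : ∀ n x, |U n (b n x)| ≤ B)
    (hUl : ∀ᵐ p ∂volume.restrict halfPlane, Tendsto (fun n => U n (w n p)) atTop (𝓝 (U' (w' p))))
    (hFl : ∀ᵐ p ∂volume.restrict halfPlane, Tendsto (fun n => F n (w n p)) atTop (𝓝 (F' (w' p))))
    (hbl : ∀ᵐ x, Tendsto (fun n => U n (b n x)) atTop (𝓝 (U' (b' x)))) {φ : ℝ × ℝ → ℝ}
    (hφ : IsTestFunction φ) :
    Tendsto (fun n => weakForm (U n) (F n) (b n) (w n) φ) atTop (𝓝 (weakForm U' F' b' w' φ)) := by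
  have hT := hφ.continuous_dT.measurable
  have hX := hφ.continuous_dX.measurable
  have hφm := hφ.1.continuous.measurable
  refine Tendsto.add ?_ ?_
  · refine tendsto_integral_of_dominated_convergence
      (fun p => B * |dT φ p| + B * |dX φ p|) (fun n => ?_) ?_ (fun n => ae_of_all _ fun p => ?_) ?_
    · have h1 := hU n
      have h2 := hF n
      have h3 := hw n
      exact (by fun_prop : Measurable fun p =>
        U n (w n p) * dT φ p + F n (w n p) * dX φ p).aestronglyMeasurable
    · exact ((hφ.integrable_dT.abs.const_mul B).add
        (hφ.integrable_dX.abs.const_mul B)).integrableOn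
    · refine (norm_add_le _ _).trans (add_le_add ?_ ?_)
      · rw [norm_mul]
        exact mul_le_mul_of_nonneg_right (hUB n p) (norm_nonneg _)
      · rw [norm_mul]
        exact mul_le_mul_of_nonneg_right (hFB n p) (norm_nonneg _)
    · filter_upwards [hUl, hFl] with p h1 h2
      exact (h1.mul_const _).add (h2.mul_const _)
  · refine tendsto_integral_of_dominated_convergence
      (fun x => B * |φ (x, 0)|) (fun n => ?_) ?_ (fun n => ae_of_all _ fun x => ?_) ?_
    · have h1 := hU n
      have h3 := hb n
      exact (by fun_prop : Measurable fun x => U n (b n x) * φ (x, 0)).aestronglyMeasurable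
    · exact (hφ.integrable_slice 0).abs.const_mul B
    · rw [norm_mul]
      exact mul_le_mul_of_nonneg_right (hbB n x) (norm_nonneg _)
    · filter_upwards [hbl] with x h1
      exact h1.mul_const _

/-! ### Kruzkov entropies as limits of strictly convex ones -/

/-- A strictly increasing approximation of `sign (z - κ)`. -/
def approxSign (κ : ℝ) (n : ℕ) (z : ℝ) : ℝ :=
  2 / Real.pi * Real.arctan ((n + 1) * (z - κ))

theorem continuous_approxSign (κ : ℝ) (n : ℕ) : Continuous (approxSign κ n) := by
  unfold approxSign
  fun_prop

theorem strictMono_approxSign (κ : ℝ) (n : ℕ) : StrictMono (approxSign κ n) := by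
  intro x y hxy
  have : ((n : ℝ) + 1) * (x - κ) < (n + 1) * (y - κ) := by gcongr
  exact mul_lt_mul_of_pos_left (Real.arctan_strictMono this) (by positivity)

theorem abs_approxSign_le (κ : ℝ) (n : ℕ) (z : ℝ) : |approxSign κ n z| ≤ 1 := by
  have h : |Real.arctan ((n + 1) * (z - κ))| ≤ Real.pi / 2 :=
    abs_le.2 ⟨(Real.neg_pi_div_two_lt_arctan _).le, (Real.arctan_lt_pi_div_two _).le⟩
  rw [approxSign, abs_mul, abs_of_pos (by positivity)]
  calc _ ≤ 2 / Real.pi * (Real.pi / 2) := by gcongr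
    _ = 1 := by field_simp

theorem tendsto_approxSign_of_gt {κ z : ℝ} (h : κ < z) :
    Tendsto (fun n => approxSign κ n z) atTop (𝓝 1) := by
  have h1 : Tendsto (fun n : ℕ => ((n : ℝ) + 1) * (z - κ)) atTop atTop :=
    (tendsto_atTop_add_const_right _ _ tendsto_natCast_atTop_atTop).atTop_mul_const (sub_pos.2 h)
  have h2 := ((Real.tendsto_arctan_atTop.mono_right nhdsWithin_le_nhds).comp h1).const_mul
    (2 / Real.pi)
  have e : 2 / Real.pi * (Real.pi / 2) = 1 := by field_simp
  rwa [e] at h2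

theorem tendsto_approxSign_of_lt {κ z : ℝ} (h : z < κ) :
    Tendsto (fun n => approxSign κ n z) atTop (𝓝 (-1)) := by
  refine (tendsto_approxSign_of_gt (κ := z) (z := κ) h).neg.congr fun n => ?_
  rw [approxSign, approxSign, ← mul_neg, ← Real.arctan_neg]
  congr 2
  ring

/-- The approximation `∫_κ^v approxSign · g'` of `|g v - g κ|` for monotone `g`. -/
def approxAbs (g : ℝ → ℝ) (κ : ℝ) (n : ℕ) (v : ℝ) : ℝ :=
  ∫ z in κ..v, approxSign κ n z * deriv g z

theorem hasDerivAt_approxAbs {g : ℝ → ℝ} (hg : Continuous (deriv g)) (κ : ℝ) (n : ℕ) (v : ℝ) :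
    HasDerivAt (approxAbs g κ n) (approxSign κ n v * deriv g v) v :=
  ((continuous_approxSign κ n).mul hg).integral_hasStrictDerivAt κ v |>.hasDerivAt

theorem continuous_approxAbs {g : ℝ → ℝ} (hg : Continuous (deriv g)) (κ : ℝ) (n : ℕ) :
    Continuous (approxAbs g κ n) :=
  continuous_iff_continuousAt.2 fun v => (hasDerivAt_approxAbs hg κ n v).continuousAt

/-- Between `κ` and `v`, away from the endpoints, the sign factor tends to a constant `±1`, and
monotonicity of `g` turns the limit into an absolute value. Taking `g = id` gives the entropy, `g =
f` its flux. -/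
theorem tendsto_approxAbs {g : ℝ → ℝ} (hg : Differentiable ℝ g) (hg' : Continuous (deriv g))
    (hmono : Monotone g) (κ v : ℝ) :
    Tendsto (fun n => approxAbs g κ n v) atTop (𝓝 |g v - g κ|) := by
  have key : ∀ s : ℝ, (∀ z ∈ uIoc κ v, z ≠ κ → z ≠ v →
      Tendsto (fun n => approxSign κ n z) atTop (𝓝 s)) →
      Tendsto (fun n => approxAbs g κ n v) atTop (𝓝 (s * (g v - g κ))) := by
    intro s hs
    have e : s * (g v - g κ) = ∫ z in κ..v, s * deriv g z := by
      rw [intervalIntegral.integral_const_mul, intervalIntegral.integral_deriv_eq_sub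
        (fun z _ => hg z) (hg'.intervalIntegrable _ _)]
    rw [e]
    refine intervalIntegral.tendsto_integral_filter_of_dominated_convergence
      (fun z => |deriv g z|) (Eventually.of_forall fun n =>
        ((continuous_approxSign κ n).mul hg').aestronglyMeasurable)
      (Eventually.of_forall fun n => ae_of_all _ fun z _ => ?_)
      (hg'.abs.intervalIntegrable _ _) ?_
    · rw [norm_mul]
      exact mul_le_of_le_one_left (norm_nonneg _) (abs_approxSign_le κ n z)
    · have h1 : ∀ᵐ z : ℝ, z ≠ κ := by simp [ae_iff]
      have h2 : ∀ᵐ z : ℝ, z ≠ v := by simp [ae_iff]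
      filter_upwards [h1, h2] with z hz1 hz2 hz
      exact (hs z hz hz1 hz2).mul_const _
  rcases le_total κ v with h | h
  · rw [abs_of_nonneg (sub_nonneg.2 (hmono h)), ← one_mul (g v - g κ)]
    refine key 1 fun z hz _ _ => tendsto_approxSign_of_gt ?_
    rw [uIoc_of_le h] at hz
    exact hz.1
  · rw [abs_of_nonpos (sub_nonpos.2 (hmono h)), ← neg_one_mul (g v - g κ)]
    refine key (-1) fun z hz hz1 _ => tendsto_approxSign_of_lt ?_
    rw [uIoc_of_ge h] at hz
    exact lt_of_le_of_ne hz.2 hz1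

theorem exists_abs_approxAbs_le {g : ℝ → ℝ} (hg : Continuous (deriv g)) {M κ : ℝ}
    (hκ : |κ| ≤ M) : ∃ B, ∀ n v, |v| ≤ M → |approxAbs g κ n v| ≤ B := by
  obtain ⟨D, hD0, hD⟩ := exists_bound_on_Icc hg M
  refine ⟨D * (M + M), fun n v hv => ?_⟩
  have h1 : ∀ z ∈ uIoc κ v, ‖approxSign κ n z * deriv g z‖ ≤ D := by
    intro z hz
    rw [norm_mul]
    have hzM : |z| ≤ M := by
      have hsub : uIcc κ v ⊆ Icc (-M) M := uIcc_subset_Icc (abs_le.1 hκ) (abs_le.1 hv)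
      exact abs_le.2 (hsub (uIoc_subset_uIcc hz))
    exact (mul_le_of_le_one_left (norm_nonneg _) (abs_approxSign_le κ n z)).trans (hD z hzM)
  refine (intervalIntegral.norm_integral_le_of_norm_le_const h1).trans ?_
  exact mul_le_mul_of_nonneg_left ((abs_sub _ _).trans (add_le_add hv hκ)) hD0

theorem isEntropyPair_approxAbs {f : ℝ → ℝ} (hf' : Continuous (deriv f)) (κ : ℝ) (n : ℕ) :
    IsEntropyPair f (approxAbs id κ n) (approxAbs f κ n) := by
  have hid : Continuous (deriv (id : ℝ → ℝ)) := by
    rw [deriv_id']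
    exact continuous_const
  have hd : ∀ v, HasDerivAt (approxAbs id κ n) (approxSign κ n v) v := fun v => by
    simpa using hasDerivAt_approxAbs hid κ n v
  have hde : deriv (approxAbs id κ n) = approxSign κ n := funext fun v => (hd v).deriv
  refine ⟨fun v => (hd v).differentiableAt, ?_, fun v => ?_⟩
  · refine StrictMono.strictConvexOn_univ_of_deriv (continuous_approxAbs hid κ n) ?_
    rw [hde]
    exact strictMono_approxSign κ n
  · rw [hde]
    exact hasDerivAt_approxAbs hf' κ n v

/-- Bounded functions satisfying all strictly convex entropy inequalities satisfy the Kruzkov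
entropy inequalities. -/
theorem almostKruzkov_of_entropy {f : ℝ → ℝ} (hf : Differentiable ℝ f)
    (hf' : Continuous (deriv f)) (hmono : Monotone f) {b : ℝ → ℝ} {w : ℝ × ℝ → ℝ}
    (hb : Measurable b) (hw : Measurable w) {M : ℝ} (hbM : ∀ x, |b x| ≤ M) (hwM : ∀ p, |w p| ≤ M)
    (h : ∀ U F, IsEntropyPair f U F →
      ∀ φ, IsTestFunction φ → (∀ p, 0 ≤ φ p) → 0 ≤ weakForm U F b w φ) (R C : ℝ) {e : ℝ}
    (he : 0 ≤ e) : AlmostKruzkov f b M R C e w := by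
  intro κ hκ φ hφ
  refine (neg_nonpos.2 he).trans ?_
  have hid : Continuous (deriv (id : ℝ → ℝ)) := by
    rw [deriv_id']
    exact continuous_const
  obtain ⟨B1, hB1⟩ := exists_abs_approxAbs_le hid hκ
  obtain ⟨B2, hB2⟩ := exists_abs_approxAbs_le hf' hκ
  have hlU : ∀ v, Tendsto (fun n => approxAbs id κ n v) atTop (𝓝 |v - κ|) := fun v =>
    tendsto_approxAbs differentiable_id hid monotone_id κ v
  have hlF := fun v => tendsto_approxAbs hf hf' hmono κ v
  have hlim := weakForm_tendsto (U := approxAbs id κ) (F := approxAbs f κ) (b := fun _ => b)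
    (w := fun _ => w) (U' := fun v => |v - κ|) (F' := fun v => |f v - f κ|) (b' := b) (w' := w)
    (B := max B1 B2) (fun n => (continuous_approxAbs hid κ n).measurable)
    (fun n => (continuous_approxAbs hf' κ n).measurable) (fun _ => hb) (fun _ => hw)
    (fun n p => (hB1 n _ (hwM p)).trans (le_max_left _ _))
    (fun n p => (hB2 n _ (hwM p)).trans (le_max_right _ _))
    (fun n x => (hB1 n _ (hbM x)).trans (le_max_left _ _))
    (ae_of_all _ fun p => hlU _) (ae_of_all _ fun p => hlF _) (ae_of_all _ fun x => hlU _)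
    hφ.test
  exact ge_of_tendsto' hlim fun n => h _ _ (isEntropyPair_approxAbs hf' κ n) φ hφ.test hφ.nonneg

theorem IsTestFunction.exists_testBound {φ : ℝ × ℝ → ℝ} (h : IsTestFunction φ)
    (h0 : ∀ p, 0 ≤ φ p) : ∃ R C, 0 ≤ R ∧ TestBound R C φ := by
  obtain ⟨R, hR0, hR⟩ := h.2.isBounded.subset_closedBall_lt 0 0
  obtain ⟨C0, hC0⟩ := h.2.exists_bound_of_continuous h.1.continuous
  obtain ⟨C1, hC1⟩ := h.1.lipschitzWith_of_hasCompactSupport h.2 (by simp)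
  have hs : ∀ w, ContDiff ℝ ∞ fun p => fderiv ℝ φ p w := fun w =>
    (h.1.fderiv_right (by simp)).clm_apply contDiff_const
  obtain ⟨C2, hC2⟩ := (hs (0, 1)).lipschitzWith_of_hasCompactSupport
    (h.hasCompactSupport_fderiv_apply _) (by simp)
  obtain ⟨C3, hC3⟩ := (hs (1, 0)).lipschitzWith_of_hasCompactSupport
    (h.hasCompactSupport_fderiv_apply _) (by simp)
  have hC00 : 0 ≤ C0 := (norm_nonneg _).trans (hC0 0)
  have key : ∀ (g : ℝ × ℝ → ℝ) (D : NNReal), LipschitzWith D g → (D : ℝ) ≤ C0 + C1 + C2 + C3 →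
      ∀ p q, |g p - g q| ≤ (C0 + C1 + C2 + C3) * ‖p - q‖ := fun g D hD hle p q => by
    have := hD.dist_le_mul p q
    rw [dist_eq_norm, dist_eq_norm] at this
    exact this.trans (mul_le_mul_of_nonneg_right hle (norm_nonneg _))
  have p1 := C1.coe_nonneg
  have p2 := C2.coe_nonneg
  have p3 := C3.coe_nonneg
  refine ⟨R, C0 + C1 + C2 + C3, hR0.le, h, h0, fun p hp => ?_, fun p => ?_,
    key _ C1 hC1 (by linarith), key _ C2 hC2 (by linarith), key _ C3 hC3 (by linarith)⟩
  · refine image_eq_zero_of_notMem_tsupport fun hmem => ?_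
    have := mem_closedBall_zero_iff.1 (hR hmem)
    linarith
  · have := (le_abs_self _).trans (hC0 p)
    linarith

/-! ### Kruzkov inequalities for the scheme -/

/-- Sequences of mesh sizes that tend to zero and satisfy the CFL condition on `[m, m']`. -/
structure IsMeshSequence (f : ℝ → ℝ) (m m' : ℝ) (Δx Δt : ℕ → ℝ) : Prop where
  space_pos : ∀ k, 0 < Δx k
  time_pos : ∀ k, 0 < Δt k
  space_lim : Tendsto Δx atTop (𝓝 0)
  time_lim : Tendsto Δt atTop (𝓝 0)
  cfl : ∀ k, ∀ v ∈ Icc m m', Δt k / Δx k * |deriv f v| ≤ 1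

/-- Two errors appear, both uniform in the level and in the test function: the consistency error of
order `Δx + Δt`, and the cost of replacing cell averages by `a` in the initial term, at most `C`
times their L¹ distance on a bounded interval. -/
theorem eventually_almostKruzkov_upwindApprox {f a : ℝ → ℝ} (hf : Differentiable ℝ f)
    (hmono : Monotone f) {m m' M : ℝ} (ha : Measurable a) (ham : ∀ x, a x ∈ Icc m m')
    (hM : ∀ v ∈ Icc m m', |v| ≤ M) {Δx Δt : ℕ → ℝ} (hΔ : IsMeshSequence f m m' Δx Δt)
    (R C : ℝ) {e : ℝ} (he : 0 < e) :
    ∀ᶠ k in atTop, AlmostKruzkov f a M R C e (upwindApprox f a (Δx k) (Δt k)) := by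
  obtain ⟨Bf, hBf0, hBf⟩ := exists_bound_on_Icc hf.continuous M
  have hM0 : 0 ≤ M := (abs_nonneg _).trans (hM _ (ham 0))
  have hfm := hf.continuous.measurable
  set R' := max R 0 with hR'
  have hR0 : 0 ≤ R' := le_max_right _ _
  set w : ℕ → ℝ × ℝ → ℝ := fun k => upwindApprox f a (Δx k) (Δt k) with hw
  have hwm : ∀ k, Measurable (w k) := fun k => measurable_upwindApprox _ _ _ _
  have hwI : ∀ k p, w k p ∈ Icc m m' := fun k p =>
    upwind_mem_Icc hf hmono ha ham (hΔ.space_pos k) (hΔ.time_pos k) (hΔ.cfl k) _ _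
  set B := (M + M) + (Bf + Bf) with hB
  set E := volume.real (closedBall (0 : ℝ × ℝ) (R' + 1)) + 2 * R' with hE
  have hlim1 : Tendsto (fun k => B * C * (Δx k + Δt k) * E) atTop (𝓝 0) := by
    simpa using ((hΔ.space_lim.add hΔ.time_lim).const_mul (B * C)).mul_const E
  have hlim2 : Tendsto (fun k => C * ∫ x in Icc (-R') R', |w k (x, 0) - a x|) atTop (𝓝 0) := by
    have h : Tendsto (fun k => ∫ x in Icc (-R') R', |w k (x, 0) - a x|) atTop
        (𝓝 (∫ x in Icc (-R') R', (0 : ℝ))) := by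
      refine tendsto_integral_of_dominated_convergence (fun _ => M + M) (fun k => ?_)
        (integrableOn_const isCompact_Icc.measure_lt_top.ne)
        (fun k => ae_of_all _ fun x => ?_) ?_
      · have := hwm k
        exact (by fun_prop : Measurable fun x => |w k (x, 0) - a x|).aestronglyMeasurable
      · rw [Real.norm_eq_abs, abs_abs]
        exact (abs_sub _ _).trans (add_le_add (hM _ (hwI _ _)) (hM _ (ham _)))
      · filter_upwards [ae_restrict_of_ae (ae_tendsto_upwindApprox_zero f ha
          (fun x => hM _ (ham x)) hΔ.space_pos hΔ.space_lim (Δt := Δt))] with x hx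
        simpa using (hx.sub_const (a x)).abs
    simpa using h.const_mul C
  have hsum := hlim1.add hlim2
  rw [add_zero] at hsum
  filter_upwards [hsum.eventually (gt_mem_nhds he),
    hΔ.space_lim.eventually (ge_mem_nhds one_pos), hΔ.time_lim.eventually (ge_mem_nhds one_pos)]
    with k hk hk1 hk2 κ hκ φ hφ
  replace hφ : TestBound R' C φ := hφ.mono (le_max_left _ _) le_rfl
  have hmain := upwindApprox_weakForm hf hmono ha ham (hΔ.space_pos k) (hΔ.time_pos k)
    (hΔ.cfl k) hk1 hk2 (U := fun v => |v - κ|) (F := fun v => |f v - f κ|) (B := B)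
    (by fun_prop) (by fun_prop)
    (discreteEntropy_kruzkov hf hmono (hΔ.cfl k)
      (div_nonneg (hΔ.time_pos k).le (hΔ.space_pos k).le) κ)
    (fun v hv => by
      rw [abs_abs]
      have := (abs_sub v κ).trans (add_le_add (hM v hv) hκ)
      linarith)
    (fun v hv => by
      rw [abs_abs]
      have := (abs_sub (f v) (f κ)).trans (add_le_add (hBf v (hM v hv)) (hBf κ hκ))
      linarith) hR0 hφ
  have hint : ∀ g : ℝ → ℝ, Measurable g → (∀ x, |g x| ≤ M) →
      Integrable fun x => |g x - κ| * φ (x, 0) := fun g hg hgM =>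
    (hφ.test.integrable_slice 0).bdd_mul (c := M + M) (by fun_prop) (ae_of_all _ fun x => by
      rw [Real.norm_eq_abs, abs_abs]
      exact (abs_sub _ _).trans (add_le_add (hgM x) hκ))
  have hwk := hwm k
  have hi1 := hint (fun x => w k (x, 0)) (by fun_prop) fun x => hM _ (hwI _ _)
  have hi2 := hint a ha fun x => hM _ (ham _)
  have hi3 : Integrable (indicator (Icc (-R') R') fun x => C * |w k (x, 0) - a x|) := by
    refine (integrable_indicator_iff measurableSet_Icc).2 (Integrable.const_mul ?_ C)
    refine Measure.integrableOn_of_bounded (M := M + M) isCompact_Icc.measure_lt_top.ne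
      (by fun_prop : Measurable fun x => |w k (x, 0) - a x|).aestronglyMeasurable
      (ae_of_all _ fun x => ?_)
    rw [Real.norm_eq_abs, abs_abs]
    exact (abs_sub _ _).trans (add_le_add (hM _ (hwI _ _)) (hM _ (ham _)))
  have hinit : ∫ x, |w k (x, 0) - κ| * φ (x, 0) ≤ (∫ x, |a x - κ| * φ (x, 0)) +
      C * ∫ x in Icc (-R') R', |w k (x, 0) - a x| := by
    rw [← integral_const_mul, ← integral_indicator measurableSet_Icc, ← integral_add hi2 hi3]
    refine integral_mono hi1 (hi2.add hi3) fun x => ?_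
    simp only
    by_cases hx : x ∈ Icc (-R') R'
    · rw [indicator_of_mem hx]
      have h1 : |w k (x, 0) - κ| ≤ |w k (x, 0) - a x| + |a x - κ| := abs_sub_le _ _ _
      have h2 := mul_le_mul_of_nonneg_right h1 (hφ.nonneg (x, 0))
      have h3 := mul_le_mul_of_nonneg_left (hφ.le (x, 0)) (abs_nonneg (w k (x, 0) - a x))
      linarith
    · have hz : φ (x, 0) = 0 := hφ.supp _ (lt_of_not_ge fun hle =>
        hx (abs_le.1 ((le_max_left _ _).trans hle)))
      simp [indicator_of_notMem hx, hz]
  simp only [weakForm] at hmain ⊢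
  linarith

/-! ### Compactness and existence -/

theorem weakForm_neg (U F u₀ : ℝ → ℝ) (u φ : ℝ × ℝ → ℝ) :
    weakForm (fun v => -U v) (fun v => -F v) u₀ u φ = -weakForm U F u₀ u φ := by
  simp only [weakForm, neg_add, ← integral_neg, neg_mul]

theorem weakForm_sub {f u₀ : ℝ → ℝ} {u : ℝ × ℝ → ℝ} {M B : ℝ} (hf : Measurable f)
    (hu₀ : Measurable u₀) (hu : Measurable u) (hu₀M : ∀ x, |u₀ x| ≤ M) (huM : ∀ p, |u p| ≤ M)
    (hfB : ∀ p, |f (u p)| ≤ B) {φ χ : ℝ × ℝ → ℝ} (hφ : IsTestFunction φ) (hχ : IsTestFunction χ) :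
    weakForm id f u₀ u (φ - χ) = weakForm id f u₀ u φ - weakForm id f u₀ u χ := by
  have hT : ∀ p, dT (φ - χ) p = dT φ p - dT χ p := fun p => by
    simp [dT, fderiv_sub (hφ.differentiable p) (hχ.differentiable p)]
  have hX : ∀ p, dX (φ - χ) p = dX φ p - dX χ p := fun p => by
    simp [dX, fderiv_sub (hφ.differentiable p) (hχ.differentiable p)]
  have hi : ∀ ψ : ℝ × ℝ → ℝ, IsTestFunction ψ →
      IntegrableOn (fun p => u p * dT ψ p + f (u p) * dX ψ p) halfPlane := fun ψ hψ =>
    ((hψ.integrable_dT.bdd_mul hu.aestronglyMeasurable (ae_of_all _ huM)).add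
      (hψ.integrable_dX.bdd_mul (hf.comp hu).aestronglyMeasurable
        (ae_of_all _ hfB))).integrableOn
  have hi0 : ∀ ψ : ℝ × ℝ → ℝ, IsTestFunction ψ → Integrable fun x => u₀ x * ψ (x, 0) :=
    fun ψ hψ => (hψ.integrable_slice 0).bdd_mul hu₀.aestronglyMeasurable (ae_of_all _ hu₀M)
  simp only [weakForm, id, hT, hX, Pi.sub_apply]
  have e1 : ∀ p, u p * (dT φ p - dT χ p) + f (u p) * (dX φ p - dX χ p) =
      (u p * dT φ p + f (u p) * dX φ p) - (u p * dT χ p + f (u p) * dX χ p) := fun p => by ring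
  have e2 : ∀ x, u₀ x * (φ (x, 0) - χ (x, 0)) = u₀ x * φ (x, 0) - u₀ x * χ (x, 0) :=
    fun x => mul_sub _ _ _
  simp only [e1, e2]
  rw [integral_sub (hi φ hφ) (hi χ hχ), integral_sub (hi0 φ hφ) (hi0 χ hχ)]
  ring

/-- Test functions are differences of nonnegative test functions. -/
theorem IsTestFunction.exists_eq_sub {φ : ℝ × ℝ → ℝ} (h : IsTestFunction φ) :
    ∃ φ₁ φ₂, IsTestFunction φ₁ ∧ IsTestFunction φ₂ ∧ (∀ p, 0 ≤ φ₁ p) ∧ (∀ p, 0 ≤ φ₂ p) ∧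
      φ = φ₁ - φ₂ := by
  obtain ⟨R, hR0, hR⟩ := h.2.isBounded.subset_closedBall_lt 0 0
  obtain ⟨C, hC⟩ := h.2.exists_bound_of_continuous h.1.continuous
  have hC0 : 0 ≤ C := (norm_nonneg _).trans (hC 0)
  -- `b = 1` on the support of `φ` and `C` bounds `|φ|`, so `φ + C b` is nonnegative.
  let b : ContDiffBump (0 : ℝ × ℝ) := ⟨R, R + 1, hR0, by linarith⟩
  have hb : IsTestFunction fun p => C * b p :=
    ⟨contDiff_const.mul b.contDiff, b.hasCompactSupport.mul_left⟩
  refine ⟨fun p => φ p + C * b p, fun p => C * b p, ⟨h.1.add hb.1, h.2.add hb.2⟩, hb,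
    fun p => ?_, fun p => mul_nonneg hC0 b.nonneg, ?_⟩
  · simp only
    by_cases hp : p ∈ tsupport φ
    · rw [b.one_of_mem_closedBall (hR hp)]
      linarith [neg_abs_le (φ p), hC p, Real.norm_eq_abs (φ p)]
    · rw [image_eq_zero_of_notMem_tsupport hp, zero_add]
      exact mul_nonneg hC0 b.nonneg
  · funext p
    simp

/-- A subsequence of a sequence that is Cauchy in `L¹_loc` of the half-plane converges almost
everywhere. -/
theorem exists_subseq_tendsto_ae {w : ℕ → ℝ × ℝ → ℝ} {M : ℝ} (hw : ∀ k, Measurable (w k))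
    (hwM : ∀ k p, |w k p| ≤ M)
    (hcauchy : ∀ (R₀ : ℝ) (η : ℝ), 0 < η → ∃ N, ∀ n ≥ N, ∀ k ≥ N,
      ∫ p in halfPlane ∩ closedBall 0 R₀, |w n p - w k p| ≤ η) :
    ∃ σ : ℕ → ℕ, StrictMono σ ∧ ∃ u : ℝ × ℝ → ℝ, Measurable u ∧
      ∀ᵐ p ∂volume.restrict halfPlane, Tendsto (fun n => w (σ n) p) atTop (𝓝 (u p)) := by
  obtain ⟨σ, hσ, hσP⟩ := extraction_forall_of_eventually'
    (P := fun N K => ∀ n ≥ K, ∀ k ≥ K,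
      ∫ p in halfPlane ∩ closedBall 0 (N : ℝ), |w n p - w k p| ≤ (1 / 2 : ℝ) ^ N) fun N => by
    obtain ⟨K, hK⟩ := hcauchy N ((1 / 2) ^ N) (by positivity)
    exact ⟨K, fun k hk n hn l hl => hK n (hk.le.trans hn) l (hk.le.trans hl)⟩
  refine ⟨σ, hσ, ?_⟩
  have hball : ∀ R : ℕ, ∀ᵐ p ∂volume.restrict (halfPlane ∩ closedBall (0 : ℝ × ℝ) R),
      ∃ l, Tendsto (fun n => w (σ n) p) atTop (𝓝 l) := by
    intro R
    set ν := volume.restrict (halfPlane ∩ closedBall (0 : ℝ × ℝ) R) with hν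
    -- The shift by `R` makes the ball of radius `N + R` in the extraction contain the fixed ball of
    -- radius `R`; the factor 2 provides the strict inequality required here.
    have hae := Lp.ae_tendsto_of_cauchy_eLpNorm (μ := ν) (f := fun n => w (σ (n + R))) (p := 1)
      (B := fun N => ENNReal.ofReal (2 * (1 / 2) ^ N))
      (fun n => (hw _).aestronglyMeasurable) le_rfl
      (summable_geometric_two.mul_left 2).tsum_ofReal_ne_top (fun N n k hn hk => by
        have hint : Integrable (fun p => w (σ (n + R)) p - w (σ (k + R)) p)
            (volume.restrict (halfPlane ∩ closedBall (0 : ℝ × ℝ) (N + R : ℕ))) := by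
          have h1 := hw (σ (n + R))
          have h2 := hw (σ (k + R))
          refine IntegrableOn.mono_set (t := closedBall 0 _) ?_ inter_subset_right
          refine Measure.integrableOn_of_bounded (M := M + M) measure_closedBall_lt_top.ne
            (by fun_prop : Measurable fun p =>
              w (σ (n + R)) p - w (σ (k + R)) p).aestronglyMeasurable (ae_of_all _ fun p => ?_)
          exact (abs_sub _ _).trans (add_le_add (hwM _ _) (hwM _ _))
        have hle : ∫⁻ p, ‖w (σ (n + R)) p - w (σ (k + R)) p‖ₑ ∂ν ≤
            ENNReal.ofReal ((1 / 2) ^ (N + R)) := by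
          have hsub : halfPlane ∩ closedBall (0 : ℝ × ℝ) R ⊆
              halfPlane ∩ closedBall (0 : ℝ × ℝ) (N + R : ℕ) :=
            inter_subset_inter_right _ (closedBall_subset_closedBall (by push_cast; linarith [
              (Nat.cast_nonneg N : (0 : ℝ) ≤ N)]))
          refine (lintegral_mono_set hsub).trans ?_
          rw [← ofReal_integral_norm_eq_lintegral_enorm hint]
          exact ENNReal.ofReal_le_ofReal (hσP (N + R) _ (hσ.monotone (by omega)) _
            (hσ.monotone (by omega)))
        rw [eLpNorm_one_eq_lintegral_enorm]
        refine hle.trans_lt ((ENNReal.ofReal_lt_ofReal_iff (by positivity)).2 ?_)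
        have h1 : (1 / 2 : ℝ) ^ (N + R) ≤ (1 / 2) ^ N :=
          pow_le_pow_of_le_one (by norm_num) (by norm_num) (Nat.le_add_right _ _)
        have h2 : (0 : ℝ) < (1 / 2) ^ N := by positivity
        linarith)
    filter_upwards [hae] with p hp
    obtain ⟨l, hl⟩ := hp
    exact ⟨l, (tendsto_add_atTop_iff_nat (f := fun n => w (σ n) p) R).1 hl⟩
  have hall : ∀ᵐ p ∂volume.restrict halfPlane, ∃ l, Tendsto (fun n => w (σ n) p) atTop (𝓝 l) := by
    have h1 : ∀ᵐ p : ℝ × ℝ, ∀ R : ℕ, p ∈ halfPlane ∩ closedBall (0 : ℝ × ℝ) R →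
        ∃ l, Tendsto (fun n => w (σ n) p) atTop (𝓝 l) := ae_all_iff.2 fun R =>
      (ae_restrict_iff' (measurableSet_halfPlane.inter measurableSet_closedBall)).1 (hball R)
    refine (ae_restrict_iff' measurableSet_halfPlane).2 ?_
    filter_upwards [h1] with p hp hpH
    obtain ⟨R, hR⟩ := exists_nat_ge ‖p‖
    exact hp R ⟨hpH, mem_closedBall_zero_iff.2 hR⟩
  exact measurable_limit_of_tendsto_metrizable_ae (fun n => (hw _).aemeasurable) hall

/-- Almost everywhere limits of the scheme are classical solutions. -/
theorem isClassicalSolution_of_tendsto {f a : ℝ → ℝ} (hf : Differentiable ℝ f)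
    (hmono : Monotone f) {m m' : ℝ} (ha : Measurable a) (ham : ∀ x, a x ∈ Icc m m')
    {Δx Δt : ℕ → ℝ} (hΔ : IsMeshSequence f m m' Δx Δt) {u : ℝ × ℝ → ℝ}
    (hu : Measurable u) (hum : ∀ p, u p ∈ Icc m m')
    (hlim : ∀ᵐ p ∂volume.restrict halfPlane,
      Tendsto (fun n => upwindApprox f a (Δx n) (Δt n) p) atTop (𝓝 (u p))) :
    IsClassicalSolution f a u := by
  -- Merely convex entropies are treated, since `id` and `-id` together yield the weak equation.
  have hent : ∀ U F : ℝ → ℝ, Differentiable ℝ U → ConvexOn ℝ univ U →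
      (∀ v, HasDerivAt F (deriv U v * deriv f v) v) → ∀ φ, IsTestFunction φ → (∀ p, 0 ≤ φ p) →
      0 ≤ weakForm U F a u φ := by
    intro U F hU hUc hF φ hφ hφ0
    have hUcont := hU.continuous
    have hFcont : Continuous F := continuous_iff_continuousAt.2 fun v => (hF v).continuousAt
    obtain ⟨R, C, hR, hRC⟩ := hφ.exists_testBound hφ0
    obtain ⟨B1, hB1⟩ := (isCompact_Icc (a := m) (b := m')).exists_bound_of_continuousOn
      hUcont.continuousOn
    obtain ⟨B2, hB2⟩ := (isCompact_Icc (a := m) (b := m')).exists_bound_of_continuousOn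
      hFcont.continuousOn
    set B := max B1 B2
    have hUB : ∀ v ∈ Icc m m', |U v| ≤ B := fun v hv => (hB1 v hv).trans (le_max_left _ _)
    have hFB : ∀ v ∈ Icc m m', |F v| ≤ B := fun v hv => (hB2 v hv).trans (le_max_right _ _)
    have haM : ∀ x, |a x| ≤ max |m| |m'| := fun x => abs_le_max_abs_abs (ham x).1 (ham x).2
    have hwI : ∀ k p, upwindApprox f a (Δx k) (Δt k) p ∈ Icc m m' := fun k p =>
      upwind_mem_Icc hf hmono ha ham (hΔ.space_pos k) (hΔ.time_pos k) (hΔ.cfl k) _ _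
    have hwm : ∀ k, Measurable (upwindApprox f a (Δx k) (Δt k)) := fun k =>
      measurable_upwindApprox _ _ _ _
    have hl := weakForm_tendsto (U := fun _ => U) (F := fun _ => F)
      (b := fun k x => upwindApprox f a (Δx k) (Δt k) (x, 0))
      (w := fun k => upwindApprox f a (Δx k) (Δt k)) (U' := U) (F' := F) (b' := a) (w' := u)
      (B := B) (fun _ => hUcont.measurable) (fun _ => hFcont.measurable)
      (fun k => (hwm k).comp (by fun_prop)) hwm (fun k p => hUB _ (hwI k p))
      (fun k p => hFB _ (hwI k p)) (fun k x => hUB _ (hwI k _))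
      (hlim.mono fun p hp => (hUcont.tendsto _).comp hp)
      (hlim.mono fun p hp => (hFcont.tendsto _).comp hp)
      ((ae_tendsto_upwindApprox_zero f ha haM hΔ.space_pos hΔ.space_lim).mono
        fun x hx => (hUcont.tendsto _).comp hx) hφ
    have hl0 : Tendsto (fun k => -(B * C * (Δx k + Δt k) *
        (volume.real (closedBall (0 : ℝ × ℝ) (R + 1)) + 2 * R))) atTop (𝓝 0) := by
      simpa using (((hΔ.space_lim.add hΔ.time_lim).const_mul (B * C)).mul_const
        (volume.real (closedBall (0 : ℝ × ℝ) (R + 1)) + 2 * R)).neg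
    refine le_of_tendsto_of_tendsto hl0 hl ?_
    filter_upwards [hΔ.space_lim.eventually (ge_mem_nhds one_pos),
      hΔ.time_lim.eventually (ge_mem_nhds one_pos)] with k hk1 hk2
    exact upwindApprox_weakForm hf hmono ha ham (hΔ.space_pos k) (hΔ.time_pos k)
      (hΔ.cfl k) hk1 hk2 hUcont.measurable hFcont.measurable
      (discreteEntropy_of_convexOn hf hmono (hΔ.cfl k)
        (div_nonneg (hΔ.time_pos k).le (hΔ.space_pos k).le) hU hUc hF) hUB hFB hR hRC
  have huM : ∀ p, |u p| ≤ max |m| |m'| := fun p => abs_le_max_abs_abs (hum p).1 (hum p).2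
  have hweak0 : ∀ φ, IsTestFunction φ → (∀ p, 0 ≤ φ p) → weakForm id f a u φ = 0 := by
    intro φ hφ hφ0
    refine le_antisymm ?_ ?_
    · rw [← neg_nonneg, ← weakForm_neg]
      refine hent _ _ differentiable_id.neg ?_ (fun v => ?_) φ hφ hφ0
      · exact (concaveOn_id convex_univ).neg
      · have : deriv (-id : ℝ → ℝ) v = -1 := (hasDerivAt_id v).neg.deriv
        rw [this, neg_one_mul]
        exact (hf v).hasDerivAt.neg
    · refine hent _ _ differentiable_id (convexOn_id convex_univ) (fun v => ?_) φ hφ hφ0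
      rw [deriv_id, one_mul]
      exact (hf v).hasDerivAt
  refine ⟨⟨memLp_top_of_bound hu.aestronglyMeasurable _ (ae_of_all _ huM), fun φ hφ => ?_⟩,
    fun U F hUF => hent U F hUF.differentiable hUF.strictConvex.convexOn hUF.hasDerivAt⟩
  obtain ⟨φ₁, φ₂, h1, h2, h1p, h2p, rfl⟩ := hφ.exists_eq_sub
  obtain ⟨B, -, hB⟩ := exists_bound_on_Icc hf.continuous (max |m| |m'|)
  rw [weakForm_sub hf.continuous.measurable ha hu
    (fun x => abs_le_max_abs_abs (ham x).1 (ham x).2) huM (fun p => hB _ (huM p)) h1 h2,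
    hweak0 _ h1 h1p, hweak0 _ h2 h2p, sub_zero]

/-- Along one admissible mesh sequence the approximations become almost Kruzkov, hence Cauchy by
stability; an almost everywhere limit of a subsequence is the solution. -/
theorem exists_isClassicalSolution {f a : ℝ → ℝ} (hf : ContDiff ℝ ∞ f) (hmono : Monotone f)
    {m m' : ℝ} (ha : Measurable a) (ham : ∀ x, a x ∈ Icc m m') :
    ∃ u : ℝ × ℝ → ℝ, Measurable u ∧ (∀ p, u p ∈ Icc m m') ∧ IsClassicalSolution f a u := by
  have hfd : Differentiable ℝ f := hf.differentiable (by simp)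
  set M := max |m| |m'| with hM
  have hIM : ∀ v ∈ Icc m m', |v| ≤ M := fun v hv => abs_le_max_abs_abs hv.1 hv.2
  obtain ⟨L, hL0, hL⟩ := exists_bound_on_Icc (hf.continuous_deriv (by simp)) M
  have hlim : Tendsto (fun k : ℕ => 1 / ((k : ℝ) + 1)) atTop (𝓝 0) :=
    tendsto_one_div_add_atTop_nhds_zero_nat
  -- The mesh ratio is `1 / (L + 1)` with `L ≥ |f'|` on the range; the added 1 covers `L = 0`.
  have hΔ : IsMeshSequence f m m' (fun k => 1 / ((k : ℝ) + 1))
      (fun k => 1 / ((k : ℝ) + 1) / (L + 1)) := by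
    refine ⟨fun k => by positivity, fun k => by positivity, hlim, by
      simpa using hlim.div_const (L + 1), fun k v hv => ?_⟩
    have e : 1 / ((k : ℝ) + 1) / (L + 1) / (1 / ((k : ℝ) + 1)) = 1 / (L + 1) := by
      field_simp
    rw [e, one_div_mul_eq_div, div_le_one (by positivity)]
    linarith [hL v (hIM v hv)]
  set w : ℕ → ℝ × ℝ → ℝ := fun k =>
    upwindApprox f a (1 / ((k : ℝ) + 1)) (1 / ((k : ℝ) + 1) / (L + 1)) with hw
  have hwm : ∀ k, Measurable (w k) := fun k => measurable_upwindApprox _ _ _ _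
  have hwI : ∀ k p, w k p ∈ Icc m m' := fun k p =>
    upwind_mem_Icc hfd hmono ha ham (hΔ.space_pos k) (hΔ.time_pos k) (hΔ.cfl k) _ _
  obtain ⟨σ, hσ, u, hu, hσu⟩ := exists_subseq_tendsto_ae hwm (fun k p => hIM _ (hwI k p))
    fun R₀ η hη => by
      obtain ⟨R, C, e, he, hstab⟩ := exists_almostKruzkov_stability hf ha
        (fun x => hIM _ (ham x)) R₀ hη
      obtain ⟨N, hN⟩ := eventually_atTop.1
        (eventually_almostKruzkov_upwindApprox hfd hmono ha ham hIM hΔ R C he)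
      exact ⟨N, fun n hn k hk => hstab _ _ (hwm n) (hwm k) (fun p => hIM _ (hwI n p))
        (fun p => hIM _ (hwI k p)) (hN n hn) (hN k hk)⟩
  have huI : ∀ᵐ p ∂volume.restrict halfPlane, u p ∈ Icc m m' := by
    filter_upwards [hσu] with p hp
    exact isClosed_Icc.mem_of_tendsto hp (Eventually.of_forall fun n => hwI _ p)
  obtain ⟨u', hu', hu'I, huu'⟩ := exists_measurable_mem_Icc hu.aemeasurable
    ((ham 0).1.trans (ham 0).2) huI
  have hΔσ : IsMeshSequence f m m' (fun k => 1 / ((σ k : ℝ) + 1))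
      (fun k => 1 / ((σ k : ℝ) + 1) / (L + 1)) :=
    ⟨fun k => hΔ.space_pos _, fun k => hΔ.time_pos _, hΔ.space_lim.comp hσ.tendsto_atTop,
      hΔ.time_lim.comp hσ.tendsto_atTop, fun k => hΔ.cfl _⟩
  refine ⟨u', hu', hu'I, isClassicalSolution_of_tendsto hfd hmono ha ham hΔσ hu' hu'I ?_⟩
  filter_upwards [hσu, huu'] with p hp hpu
  rw [← hpu]
  exact hp

/-! ### Uniqueness and convergence -/

theorem IsClassicalSolution.congr {f u₀ u₀' : ℝ → ℝ} {u u' : ℝ × ℝ → ℝ}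
    (h : IsClassicalSolution f u₀ u) (h₀ : u₀ =ᵐ[volume] u₀')
    (hu : u =ᵐ[volume.restrict halfPlane] u') : IsClassicalSolution f u₀' u' :=
  ⟨⟨h.memLp_top.ae_eq hu, fun φ hφ => by rw [← weakForm_congr h₀ hu, h.weak φ hφ]⟩,
    fun U F hUF φ hφ hφ0 => by
      rw [← weakForm_congr h₀ hu]
      exact h.entropy U F hUF φ hφ hφ0⟩

/-- Classical solutions have zero Kruzkov defect, so stability applies with every tolerance. No
maximum principle is known for the competitor `v`; the bound `M` on levels is enlarged to cover its
range. -/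
theorem IsClassicalSolution.ae_eq {f a : ℝ → ℝ} (hf : ContDiff ℝ ∞ f) (hmono : Monotone f)
    {m m' : ℝ} (ha : Measurable a) (ham : ∀ x, a x ∈ Icc m m') {u v : ℝ × ℝ → ℝ}
    (hu : Measurable u) (hum : ∀ p, u p ∈ Icc m m') (hus : IsClassicalSolution f a u)
    (hvs : IsClassicalSolution f a v) : v =ᵐ[volume.restrict halfPlane] u := by
  have hfd : Differentiable ℝ f := hf.differentiable (by simp)
  have hf' : Continuous (deriv f) := hf.continuous_deriv (by simp)
  set N := (eLpNorm v ∞ (volume.restrict halfPlane)).toReal with hN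
  have hvN : ∀ᵐ p ∂volume.restrict halfPlane, v p ∈ Icc (-N) N := by
    filter_upwards [ae_le_eLpNormEssSup (f := v) (μ := volume.restrict halfPlane)] with p hp
    rw [mem_Icc, ← abs_le, hN, ← Real.norm_eq_abs, ← toReal_enorm]
    exact ENNReal.toReal_mono hvs.memLp_top.2.ne (by rwa [eLpNorm_exponent_top])
  have hN0 : 0 ≤ N := ENNReal.toReal_nonneg
  obtain ⟨v', hv', hv'I, hvv'⟩ := exists_measurable_mem_Icc
    hvs.memLp_top.1.aemeasurable (by linarith) hvN
  have hvs' := hvs.congr (EventuallyEq.refl _ _) hvv'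
  set M := max (max |m| |m'|) N with hM
  have hIM : ∀ v ∈ Icc m m', |v| ≤ M := fun v hv =>
    (abs_le_max_abs_abs hv.1 hv.2).trans (le_max_left _ _)
  have hv'M : ∀ p, |v' p| ≤ M := fun p => (abs_le.2 (hv'I p)).trans (le_max_right _ _)
  have haM : ∀ x, |a x| ≤ M := fun x => hIM _ (ham x)
  have huM : ∀ p, |u p| ≤ M := fun p => hIM _ (hum p)
  refine hvv'.trans ?_
  have hball : ∀ R₀ : ℕ, ∀ᵐ p ∂volume.restrict (halfPlane ∩ closedBall (0 : ℝ × ℝ) R₀),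
      v' p = u p := by
    intro R₀
    have hint : IntegrableOn (fun p => |v' p - u p|) (halfPlane ∩ closedBall (0 : ℝ × ℝ) R₀) := by
      refine IntegrableOn.mono_set (t := closedBall 0 _) ?_ inter_subset_right
      refine Measure.integrableOn_of_bounded (M := M + M) measure_closedBall_lt_top.ne
        (by fun_prop : Measurable fun p => |v' p - u p|).aestronglyMeasurable
        (ae_of_all _ fun p => ?_)
      rw [Real.norm_eq_abs, abs_abs]
      exact (abs_sub _ _).trans (add_le_add (hv'M p) (huM p))
    have h0 : ∫ p in halfPlane ∩ closedBall (0 : ℝ × ℝ) R₀, |v' p - u p| = 0 := by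
      refine le_antisymm (le_of_forall_pos_le_add fun η hη => ?_)
        (integral_nonneg fun p => abs_nonneg _)
      obtain ⟨R, C, e, he, hstab⟩ := exists_almostKruzkov_stability hf ha haM R₀ hη
      rw [zero_add]
      exact hstab _ _ hv' hu hv'M huM
        (almostKruzkov_of_entropy hfd hf' hmono ha hv' haM hv'M hvs'.entropy R C he.le)
        (almostKruzkov_of_entropy hfd hf' hmono ha hu haM huM hus.entropy R C he.le)
    rw [integral_eq_zero_iff_of_nonneg (fun p => abs_nonneg _) hint] at h0
    filter_upwards [h0] with p hp
    exact sub_eq_zero.1 (abs_eq_zero.1 hp)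
  have h1 : ∀ᵐ p : ℝ × ℝ, ∀ R : ℕ, p ∈ halfPlane ∩ closedBall (0 : ℝ × ℝ) R → v' p = u p :=
    ae_all_iff.2 fun R =>
      (ae_restrict_iff' (measurableSet_halfPlane.inter measurableSet_closedBall)).1 (hball R)
  refine (ae_restrict_iff' measurableSet_halfPlane).2 ?_
  filter_upwards [h1] with p hp hpH
  obtain ⟨R, hR⟩ := exists_nat_ge ‖p‖
  exact hp R ⟨hpH, mem_closedBall_zero_iff.2 hR⟩

/-- Convergence of the scheme in `L¹_loc`. -/
theorem tendsto_lintegral_upwindApprox {f a : ℝ → ℝ} (hf : ContDiff ℝ ∞ f) (hmono : Monotone f)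
    {m m' : ℝ} (ha : Measurable a) (ham : ∀ x, a x ∈ Icc m m') {u : ℝ × ℝ → ℝ}
    (hu : Measurable u) (hum : ∀ p, u p ∈ Icc m m') (hus : IsClassicalSolution f a u)
    {Δx Δt : ℕ → ℝ} (hΔ : IsMeshSequence f m m' Δx Δt) {K : Set (ℝ × ℝ)} (hK : IsCompact K)
    (hK0 : K ⊆ {p | 0 ≤ p.2}) :
    Tendsto (fun k => ∫⁻ p in K, ‖upwindApprox f a (Δx k) (Δt k) p - u p‖ₑ) atTop (𝓝 0) := by
  have hfd : Differentiable ℝ f := hf.differentiable (by simp)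
  have hf' : Continuous (deriv f) := hf.continuous_deriv (by simp)
  set M := max |m| |m'| with hM
  have hIM : ∀ v ∈ Icc m m', |v| ≤ M := fun v hv => abs_le_max_abs_abs hv.1 hv.2
  have haM : ∀ x, |a x| ≤ M := fun x => hIM _ (ham x)
  have huM : ∀ p, |u p| ≤ M := fun p => hIM _ (hum p)
  obtain ⟨R₀, hR₀⟩ := hK.isBounded.subset_closedBall (0 : ℝ × ℝ)
  -- `K` may touch the line `t = 0`, which is null.
  have hKae : K ≤ᵐ[volume] (halfPlane ∩ closedBall (0 : ℝ × ℝ) R₀ : Set (ℝ × ℝ)) := by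
    have h0 : ∀ᵐ s : ℝ, s ≠ 0 := by simp [ae_iff]
    have hne : ∀ᵐ p : ℝ × ℝ, p.2 ≠ 0 := by
      rw [Measure.volume_eq_prod]
      exact Measure.quasiMeasurePreserving_snd.ae h0
    filter_upwards [hne] with p hp hpK
    exact ⟨lt_of_le_of_ne (hK0 hpK) (Ne.symm hp), hR₀ hpK⟩
  rw [ENNReal.tendsto_nhds_zero]
  intro ε hε
  obtain ⟨η, hη0, hηε⟩ := ENNReal.lt_iff_exists_nnreal_btwn.1 hε
  have hη : 0 < (η : ℝ) := by exact_mod_cast hη0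
  obtain ⟨R, C, e, he, hstab⟩ := exists_almostKruzkov_stability hf ha haM R₀ hη
  filter_upwards [eventually_almostKruzkov_upwindApprox hfd hmono ha ham hIM hΔ R C he] with k hk
  have hwI : ∀ p, upwindApprox f a (Δx k) (Δt k) p ∈ Icc m m' := fun p =>
    upwind_mem_Icc hfd hmono ha ham (hΔ.space_pos k) (hΔ.time_pos k) (hΔ.cfl k) _ _
  have hwm := measurable_upwindApprox f a (Δx k) (Δt k)
  have hint : IntegrableOn (fun p => upwindApprox f a (Δx k) (Δt k) p - u p)
      (halfPlane ∩ closedBall (0 : ℝ × ℝ) R₀) := by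
    refine IntegrableOn.mono_set (t := closedBall 0 _) ?_ inter_subset_right
    refine Measure.integrableOn_of_bounded (M := M + M) measure_closedBall_lt_top.ne
      (by fun_prop : Measurable fun p =>
        upwindApprox f a (Δx k) (Δt k) p - u p).aestronglyMeasurable (ae_of_all _ fun p => ?_)
    exact (abs_sub _ _).trans (add_le_add (hIM _ (hwI p)) (huM p))
  refine (lintegral_mono_set' hKae).trans ?_
  rw [← ofReal_integral_norm_eq_lintegral_enorm hint]
  refine le_trans ?_ hηε.le
  rw [← ENNReal.ofReal_coe_nnreal]
  exact ENNReal.ofReal_le_ofReal (hstab _ _ hwm hu (fun p => hIM _ (hwI p)) huM hk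
    (almostKruzkov_of_entropy hfd hf' hmono ha hu haM huM hus.entropy R C he.le))

/-- Essential bounds of a real function are meaningful only if it is essentially bounded, which
membership in L∞ supplies. -/
theorem ae_mem_dataRange {u₀ : ℝ → ℝ} (hu₀ : MemLp u₀ ∞ volume) :
    ∀ᵐ x, u₀ x ∈ dataRange u₀ := by
  set N := (eLpNorm u₀ ∞ volume).toReal
  have hN : ∀ᵐ x, |u₀ x| ≤ N := by
    filter_upwards [ae_le_eLpNormEssSup (f := u₀) (μ := volume)] with x hx
    rw [← Real.norm_eq_abs, ← toReal_enorm]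
    exact ENNReal.toReal_mono hu₀.2.ne (by rwa [eLpNorm_exponent_top])
  have h1 : IsBoundedUnder (· ≤ ·) (ae volume) u₀ :=
    isBoundedUnder_of_eventually_le (hN.mono fun x hx => (abs_le.1 hx).2)
  have h2 : IsBoundedUnder (· ≥ ·) (ae volume) u₀ :=
    isBoundedUnder_of_eventually_ge (hN.mono fun x hx => (abs_le.1 hx).1)
  filter_upwards [ae_le_essSup h1, ae_essInf_le h2] with x hx1 hx2
  exact ⟨hx2, hx1⟩

/-- The data enter only through integrals over cells, so the scheme does not see the choice of
representative. -/
theorem upwindApprox_congr {f u₀ a : ℝ → ℝ} (h : u₀ =ᵐ[volume] a) (Δx Δt : ℝ) :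
    upwindApprox f u₀ Δx Δt = upwindApprox f a Δx Δt := by
  have h0 : cellAverage Δx u₀ = cellAverage Δx a := by
    funext j
    rw [cellAverage, cellAverage, intervalIntegral.integral_congr_ae (h.mono fun x hx _ => hx)]
  have hn : ∀ n, upwind f u₀ Δx Δt n = upwind f a Δx Δt n := by
    intro n
    induction n with
    | zero => exact h0
    | succ n ih => simp only [upwind, ih]
  funext p
  simp only [upwindApprox, hn]

end ScalarConservationLaw

end

theorem mainTheorem4 (f : ℝ → ℝ) (hf : ContDiff ℝ ∞ f) (hf' : ∀ v, 0 ≤ deriv f v)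
    (u₀ : ℝ → ℝ) (hu₀ : MemLp u₀ ∞ volume) :
    ∃ u : ℝ × ℝ → ℝ,
      ScalarConservationLaw.IsClassicalSolution f u₀ u ∧
      (∀ v : ℝ × ℝ → ℝ, ScalarConservationLaw.IsClassicalSolution f u₀ v →
        v =ᵐ[volume.restrict ScalarConservationLaw.halfPlane] u) ∧
      ∀ Δx Δt : ℕ → ℝ, (∀ k, 0 < Δx k) → (∀ k, 0 < Δt k) →
        Tendsto Δx atTop (𝓝 0) → Tendsto Δt atTop (𝓝 0) →
        (∀ k, ScalarConservationLaw.CFL f u₀ (Δx k) (Δt k)) →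
        ∀ K : Set (ℝ × ℝ), IsCompact K → K ⊆ {p | 0 ≤ p.2} →
          Tendsto
            (fun k => ∫⁻ p in K,
              ‖ScalarConservationLaw.upwindApprox f u₀ (Δx k) (Δt k) p - u p‖ₑ)
            atTop (𝓝 0) := by
  have hmono : Monotone f := monotone_of_deriv_nonneg (hf.differentiable (by simp)) hf'
  have hmem := ScalarConservationLaw.ae_mem_dataRange hu₀
  obtain ⟨x, hx⟩ := hmem.exists
  -- A representative with all values in `[ess inf u₀, ess sup u₀]`: with these endpoints the
  -- assumed CFL condition is the one in `IsMeshSequence`.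
  obtain ⟨a, ha, ham, hau⟩ := ScalarConservationLaw.exists_measurable_mem_Icc
    hu₀.1.aemeasurable (hx.1.trans hx.2) hmem
  obtain ⟨u, hu, hum, hus⟩ := ScalarConservationLaw.exists_isClassicalSolution hf hmono ha ham
  refine ⟨u, hus.congr hau.symm (EventuallyEq.refl _ _), fun v hv => ?_, ?_⟩
  · exact ScalarConservationLaw.IsClassicalSolution.ae_eq hf hmono ha ham hu hum hus
      (hv.congr hau (EventuallyEq.refl _ _))
  · intro Δx Δt hΔx hΔt hΔx0 hΔt0 hcfl K hK hK0
    simp only [ScalarConservationLaw.upwindApprox_congr hau]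
    exact ScalarConservationLaw.tendsto_lintegral_upwindApprox hf hmono ha ham hu hum hus
      ⟨hΔx, hΔt, hΔx0, hΔt0, hcfl⟩ hK hK0
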